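/- Let $d,n\ge 1$ be integers. Let $\mathcal R$ be the family of sets $A\subsetneq\mathbb R^d$ that are open, increasing ($x\in A$ and $a\in[0,\infty)^d$ imply $x+a\in A$), have convex complement, and satisfy $0\notin\overline A$. Fix $A\in\mathcal R$ and let $X^{(1)},\dots,X^{(n)}$ be random vectors on a common probability space with values in $[0,\infty)^d$ almost surely and with laws $F_1,\dots,F_n$. Put $Y_A^{(i)}=\sup\{u: X^{(i)}\in uA\}$ (with $\sup\emptyset=0$) and let $F_A^{(i)}$ be the law of $Y_A^{(i)}$. For a probability law $V$ on $[0,\infty)$ with tail $\overline V(x)=V((x,\infty))>0$ for all $x\ge 0$, write * $V\in\mathcal C$ if $\lim_{b\uparrow 1}\limsup_{x\to\infty}\overline V(bx)/\overline V(x)=1$; * $V\in\mathcal D$ if $\limsup_{x\to\infty}\overline V(bx)/\overline V(x)<\infty$ for every $b\in(0,1)$; * $V\in\mathcal L$ if $\lim_{x\to\infty}\overline V(x-a)/\overline V(x)=1$ for every $a>0$; * $V\in\mathcal S$ if $\lim_{x\to\infty}\overline{V^{m*}}(x)/\overline V(x)=m$ for every integer $m\ge 2$, where $V^{m*}$ is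 the $m$-fold convolution. For a class $\mathcal B$ of such laws, $F_i\in\mathcal B_A$ means $F_A^{(i)}\in\mathcal B$. Then the single-big-jump relation $$\mathbb P\big[X^{(1)}+\dots+X^{(n)}\in xA\big]\sim\sum_{i=1}^n\mathbb P\big[X^{(i)}\in xA\big],\qquad x\to\infty,$$ (that is, the ratio of the two sides tends to $1$) holds in each of the following three cases. 1. $F_1,\dots,F_n\in\mathcal C_A$, and the vectors are quasi-asymptotically independent on $A$: for all $i\ne j$, $$\lim_{x\to\infty}\frac{\mathbb P[Y_A^{(i)}>x,\;Y_A^{(j)}>x]}{\mathbb P[Y_A^{(i)}>x]+\mathbb P[Y_A^{(j)}>x]}=0.$$ 2. $F_1,\dots,F_n\in(\mathcal D\cap\mathcal L)_A$, and the vectors are tail asymptotically independent on $A$: for all $i\ne j$, $\lim_{x_i\wedge x_j\to\infty}\mathbb P[Y_A^{(i)}>x_i\mid Y_A^{(j)}>x_j]=0$. 3. $F_1,\dots,F_n\in\mathcal S_A$; the vectors are regression dependent on $A$: there are constants $x_0\in\mathbb R$ and $C\ge 0$ such that for every $i$, every non-empty $J\subseteq\{1,\dots,n\}\setminus\{i\}$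 and every $x>x_0$, $$\mathbb P\big[Y_A^{(i)}>x\mid Y_A^{(j)}=y_j,\ j\in J\big]\le C\,\mathbb P[Y_A^{(i)}>x]$$ for almost every $(y_j)_{j\in J}$ (under the law of $(Y_A^{(j)})_{j\in J}$) with $y_j>x_0$ for all $j\in J$, the left side being the regular conditional distribution; and the convolution $F_A^{(i)}*F_A^{(j)}$ belongs to $\mathcal S$ for all $i\ne j$. -/

import Mathlib

open Set Filter Topology MeasureTheory ProbabilityTheory
open scoped ENNReal NNReal Pointwise

/-- The family of sets `A ⊊ ℝ^d` that are open, increasing (`x ∈ A` and `a ≥ 0` componentwise imply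
`x + a ∈ A`), have convex complement, and satisfy `0 ∉ closure A`. -/
def rareSets (d : ℕ) : Set (Set (Fin d → ℝ)) :=
  {A | A ⊂ Set.univ ∧ IsOpen A ∧ (∀ x ∈ A, ∀ a : Fin d → ℝ, 0 ≤ a → x + a ∈ A) ∧
    Convex ℝ Aᶜ ∧ (0 : Fin d → ℝ) ∉ closure A}

/-- The functional `x ↦ sup {u : x ∈ u A}`. For `A ∈ rareSets d` the set of such `u` is bounded
above; it can be empty, and the supremum is then `0`. -/
noncomputable def setRadius {d : ℕ} (A : Set (Fin d → ℝ)) (x : Fin d → ℝ) : ℝ :=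
  sSup {u : ℝ | x ∈ u • A}

/-- The law `F_A` of `Y_A = sup {u : X ∈ u A}`, where the random vector `X` has law `F`. -/
noncomputable def lawOn {d : ℕ} (A : Set (Fin d → ℝ)) (F : Measure (Fin d → ℝ)) : Measure ℝ :=
  F.map (setRadius A)

/-- The tail `x ↦ V (x, ∞)` of a distribution on the real line. -/
noncomputable def tail (V : Measure ℝ) (x : ℝ) : ℝ≥0∞ := V (Ioi x)

/-- Distributions on `[0, ∞)` whose tail is positive at every `x ≥ 0`. -/
def positiveTail : Set (Measure ℝ) :=
  {V | IsProbabilityMeasure V ∧ V (Iio 0) = 0 ∧ ∀ x : ℝ, 0 ≤ x → 0 < tail V x}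

/-- The class `𝓛` of long-tailed distributions. -/
def longTailed : Set (Measure ℝ) :=
  {V | V ∈ positiveTail ∧
    ∀ a : ℝ, 0 < a → Tendsto (fun x : ℝ => tail V (x - a) / tail V x) atTop (𝓝 1)}

/-- The class `𝓓` of dominatedly varying distributions. -/
def dominatedlyVarying : Set (Measure ℝ) :=
  {V | V ∈ positiveTail ∧
    ∀ b : ℝ, 0 < b → b < 1 → limsup (fun x : ℝ => tail V (b * x) / tail V x) atTop < ∞}

/-- The class `𝓒` of consistently varying distributions. -/
def consistentlyVarying : Set (Measure ℝ) :=
  {V | V ∈ positiveTail ∧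
    Tendsto (fun b : ℝ => limsup (fun x : ℝ => tail V (b * x) / tail V x) atTop) (𝓝[<] 1) (𝓝 1)}

/-- The `n`-fold convolution of a distribution with itself. -/
noncomputable def convPow (V : Measure ℝ) : ℕ → Measure ℝ
  | 0 => Measure.dirac 0
  | n + 1 => (convPow V n).conv V

/-- The class `𝓢` of subexponential distributions. -/
def subexponential : Set (Measure ℝ) :=
  {V | V ∈ positiveTail ∧
    ∀ n : ℕ, 2 ≤ n → Tendsto (fun x : ℝ => tail (convPow V n) x / tail V x) atTop (𝓝 (n : ℝ≥0∞))}

/-- For a class `𝓑` of distributions on the real line, the class `𝓑_A` of distributions `F` on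
`ℝ^d` with `F_A ∈ 𝓑`. -/
def classOn {d : ℕ} (𝓑 : Set (Measure ℝ)) (A : Set (Fin d → ℝ)) : Set (Measure (Fin d → ℝ)) :=
  {F | lawOn A F ∈ 𝓑}

section Dependence

variable {Ω : Type*} [MeasurableSpace Ω]

/-- Quasi-asymptotic independence of real random variables. -/
def QAI {n : ℕ} (P : Measure Ω) (Y : Fin n → Ω → ℝ) : Prop :=
  ∀ i j : Fin n, i ≠ j →
    Tendsto (fun x : ℝ => P {ω | x < Y i ω ∧ x < Y j ω} / (P {ω | x < Y i ω} + P {ω | x < Y j ω}))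
      atTop (𝓝 0)

/-- Tail asymptotic independence of real random variables. The filter says that both thresholds
tend to infinity, at arbitrary relative speed. -/
def TAI {n : ℕ} (P : Measure Ω) (Y : Fin n → Ω → ℝ) : Prop :=
  ∀ i j : Fin n, i ≠ j →
    Tendsto (fun p : ℝ × ℝ => ProbabilityTheory.cond P {ω | p.2 < Y j ω} {ω | p.1 < Y i ω})
      (atTop ×ˢ atTop) (𝓝 0)

/-- Regression dependence of real random variables: with constants `x₀` and `C`,
`P[Y_i > x | Y_j = y_j, j ∈ J] ≤ C P[Y_i > x]` for all `i`, all non-empty `J` not containing `i`,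
all `x > x₀` and all `y_j > x₀`. The conditional probability is the regular conditional
distribution, so the bound is required for almost every `y` under the law of `(Y_j)_{j ∈ J}`. -/
def RegressionDependent {n : ℕ} (P : Measure Ω) [IsFiniteMeasure P] (Y : Fin n → Ω → ℝ) : Prop :=
  ∃ (x₀ : ℝ) (C : ℝ≥0), ∀ (i : Fin n) (J : Finset (Fin n)), J.Nonempty → i ∉ J →
    ∀ x : ℝ, x₀ < x → ∀ᵐ y ∂(P.map (fun ω (j : J) => Y j ω)), (∀ j : J, x₀ < y j) →
      condDistrib (Y i) (fun ω (j : J) => Y j ω) P y (Ioi x) ≤ C * P {ω | x < Y i ω}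

/-- The random variables `Y_A^{(i)} = sup {u : X^{(i)} ∈ u A}`. -/
noncomputable def radii {d n : ℕ} (A : Set (Fin d → ℝ)) (X : Fin n → Ω → Fin d → ℝ) :
    Fin n → Ω → ℝ :=
  fun i ω => setRadius A (X i ω)

/-- The single-big-jump relation `P[X^{(1)} + ⋯ + X^{(n)} ∈ x A] ∼ ∑ i, P[X^{(i)} ∈ x A]` as
`x → ∞`: the ratio of the two sides tends to `1`. -/
def SingleBigJump {d n : ℕ} (P : Measure Ω) (A : Set (Fin d → ℝ)) (X : Fin n → Ω → Fin d → ℝ) :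
    Prop :=
  Tendsto (fun x : ℝ => P {ω | ∑ i, X i ω ∈ x • A} / ∑ i, P {ω | X i ω ∈ x • A}) atTop (𝓝 1)

end Dependence

/-! ### The gauge of a rare set: monotonicity, subadditivity, measurability. -/

section Geometry

variable {d : ℕ} {A : Set (Fin d → ℝ)}

/-! The problem reduces to real random variables through the gauge `setRadius A`. On nonnegative
vectors, membership in `x • A` with `x > 0` is exactly the event that the gauge exceeds `x`
(`lt_setRadius_iff`). Convexity of the complement makes the gauge subadditive, and monotonicity of
`A` keeps the sum of the vectors in `x • A` once one of them is there. Hence, for the gauges `Y i`,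
the probability in question lies between that of some `Y i > x` and that of `∑ Y i > x`. By
`singleBigJump_of_negligible` it remains to show that joint exceedances of pairs are negligible
(Bonferroni then gives the lower bound) and that `P[∑ Y i > x] ≤ (1 + ε) ∑ P[Y i > x]` eventually.

For the upper bound in cases 1 and 2, a sum above `x` has either one term above `x - s`, or one
above `x / n` and another above `s / n`. Consistent variation allows `s` proportional to `x`; long
tails allow only a constant `s`, which is why the dependence condition must then treat thresholds of
different orders.

In case 3 the sum is built one variable at a time. Regression dependence bounds the event that a
partial sum and the next variable are both large by `C` times the same probability under
independence (`measure_le_mul_jointTail`). That probability is controlled by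
`eventually_jointTail_le`, where subexponentiality of the pairwise convolutions enters. -/

theorem smul_mem_smul_of_le (hA : A ∈ rareSets d) {x : Fin d → ℝ} (hx : 0 ≤ x) {u v : ℝ}
    (hu : 0 < u) (huv : u ≤ v) (h : x ∈ v • A) : x ∈ u • A := by
  have hv : 0 < v := hu.trans_le huv
  rw [Set.mem_smul_set_iff_inv_smul_mem₀ hv.ne'] at h
  rw [Set.mem_smul_set_iff_inv_smul_mem₀ hu.ne']
  have h1 : (0 : Fin d → ℝ) ≤ (u⁻¹ - v⁻¹) • x :=
    smul_nonneg (sub_nonneg.2 (inv_anti₀ hu huv)) hx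
  have h2 := hA.2.2.1 _ h _ h1
  rwa [← add_smul, add_sub_cancel] at h2

theorem add_mem_smul (hA : A ∈ rareSets d) {x a : Fin d → ℝ} (ha : 0 ≤ a) {u : ℝ}
    (hu : 0 < u) (h : x ∈ u • A) : x + a ∈ u • A := by
  rw [Set.mem_smul_set_iff_inv_smul_mem₀ hu.ne'] at h ⊢
  rw [smul_add]
  exact hA.2.2.1 _ h _ (smul_nonneg (inv_nonneg.2 hu.le) ha)

theorem bddAbove_setOf_mem_smul (hA : A ∈ rareSets d) (x : Fin d → ℝ) :
    BddAbove {u : ℝ | x ∈ u • A} := by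
  have h1 : Tendsto (fun u : ℝ => u⁻¹ • x) atTop (𝓝 0) := by
    simpa using (tendsto_inv_atTop_zero (𝕜 := ℝ)).smul_const x
  have h2 : ∀ᶠ u : ℝ in atTop, u⁻¹ • x ∉ A := by
    filter_upwards [h1.eventually (isClosed_closure.isOpen_compl.mem_nhds hA.2.2.2.2)] with u hu hm
    exact hu (subset_closure hm)
  obtain ⟨M, hM⟩ := eventually_atTop.1 h2
  refine ⟨max M 1, fun u hu => ?_⟩
  by_contra! hlt
  have hpos : 0 < u := lt_of_lt_of_le one_pos ((le_max_right M 1).trans hlt.le)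
  exact hM u ((le_max_left _ _).trans hlt.le)
    ((Set.mem_smul_set_iff_inv_smul_mem₀ hpos.ne' _ _).1 hu)

/-- Openness of `A` makes the inequality strict: membership at level `u` persists at a slightly
larger level. -/
theorem lt_setRadius_iff (hA : A ∈ rareSets d) {x : Fin d → ℝ} (hx : 0 ≤ x) {u : ℝ} (hu : 0 < u) :
    u < setRadius A x ↔ x ∈ u • A := by
  constructor
  · intro h
    have hne : {u : ℝ | x ∈ u • A}.Nonempty := by
      by_contra hne
      rw [Set.not_nonempty_iff_eq_empty] at hne
      rw [setRadius, hne, Real.sSup_empty] at h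
      exact lt_asymm h hu
    obtain ⟨v, hv, huv⟩ := exists_lt_of_lt_csSup hne h
    exact smul_mem_smul_of_le hA hx hu huv.le hv
  · intro h
    rw [Set.mem_smul_set_iff_inv_smul_mem₀ hu.ne'] at h
    have hc : ContinuousAt (fun v : ℝ => v⁻¹ • x) u :=
      (continuousAt_inv₀ hu.ne').smul continuousAt_const
    have h1 : ∀ᶠ v in 𝓝[>] u, v⁻¹ • x ∈ A :=
      nhdsWithin_le_nhds (hc.eventually (hA.2.1.mem_nhds h))
    obtain ⟨v, hv, huv⟩ := (h1.and self_mem_nhdsWithin).exists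
    have huv : u < v := huv
    refine huv.trans_le (le_csSup (bddAbove_setOf_mem_smul hA x) ?_)
    exact (Set.mem_smul_set_iff_inv_smul_mem₀ (hu.trans huv).ne' _ _).2 hv

theorem setRadius_nonneg (hA : A ∈ rareSets d) {x : Fin d → ℝ} (hx : 0 ≤ x) :
    0 ≤ setRadius A x := by
  refine Real.sSup_nonneg fun u hu => ?_
  -- A negative level is impossible: adding a nonnegative multiple of `x` to `u⁻¹ • x` would put `0`
  -- in `A`.
  by_contra! hneg
  have hu' := (Set.mem_smul_set_iff_inv_smul_mem₀ hneg.ne _ _).1 hu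
  have h1 : (0 : Fin d → ℝ) ≤ (-u⁻¹) • x := smul_nonneg (by simpa using hneg.le) hx
  have h2 := hA.2.2.1 _ hu' _ h1
  rw [← add_smul, add_neg_cancel, zero_smul] at h2
  exact hA.2.2.2.2 (subset_closure h2)

/-- For `r`, `s` just above the two gauges, `x / r` and `y / s` lie in the convex set `Aᶜ`, and `(x
+ y) / (r + s)` is their convex combination with weights proportional to `r` and `s`. -/
theorem setRadius_add_le (hA : A ∈ rareSets d) {x y : Fin d → ℝ} (hx : 0 ≤ x) (hy : 0 ≤ y) :
    setRadius A (x + y) ≤ setRadius A x + setRadius A y := by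
  refine le_of_forall_pos_le_add fun ε hε => ?_
  set r := setRadius A x + ε / 2 with hr
  set s := setRadius A y + ε / 2 with hs
  have hr0 : 0 < r := by have := setRadius_nonneg hA hx; positivity
  have hs0 : 0 < s := by have := setRadius_nonneg hA hy; positivity
  have h1 : r⁻¹ • x ∈ Aᶜ := fun h => by
    have := (lt_setRadius_iff hA hx hr0).2 ((Set.mem_smul_set_iff_inv_smul_mem₀ hr0.ne' _ _).2 h)
    linarith
  have h2 : s⁻¹ • y ∈ Aᶜ := fun h => by
    have := (lt_setRadius_iff hA hy hs0).2 ((Set.mem_smul_set_iff_inv_smul_mem₀ hs0.ne' _ _).2 h)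
    linarith
  have hrs : 0 < r + s := add_pos hr0 hs0
  have h3 := hA.2.2.2.1 h1 h2 (div_nonneg hr0.le hrs.le) (div_nonneg hs0.le hrs.le)
    (by field_simp)
  have h4 : (r / (r + s)) • r⁻¹ • x + (s / (r + s)) • s⁻¹ • y = (r + s)⁻¹ • (x + y) := by
    rw [smul_smul, smul_smul, smul_add]
    congr 2 <;> field_simp
  rw [h4] at h3
  have h5 : ¬ (r + s < setRadius A (x + y)) := fun h =>
    h3 ((Set.mem_smul_set_iff_inv_smul_mem₀ hrs.ne' _ _).1
      ((lt_setRadius_iff hA (add_nonneg hx hy) hrs).1 h))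
  linarith

theorem setRadius_sum_le (hA : A ∈ rareSets d) {ι : Type*} (s : Finset ι) {x : ι → Fin d → ℝ}
    (hx : ∀ i, 0 ≤ x i) : setRadius A (∑ i ∈ s, x i) ≤ ∑ i ∈ s, setRadius A (x i) := by
  classical
  induction s using Finset.induction_on with
  | empty =>
    simp only [Finset.sum_empty]
    by_contra! h
    have h1 := (lt_setRadius_iff hA le_rfl (half_pos h)).1 (half_lt_self h)
    rw [Set.mem_smul_set_iff_inv_smul_mem₀ (half_pos h).ne', smul_zero] at h1
    exact hA.2.2.2.2 (subset_closure h1)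
  | insert i s hi ih =>
    rw [Finset.sum_insert hi, Finset.sum_insert hi]
    exact (setRadius_add_le hA (hx i) (Finset.sum_nonneg fun j _ => hx j)).trans (by gcongr)

theorem sum_mem_smul_of_mem (hA : A ∈ rareSets d) {ι : Type*} {s : Finset ι} {x : ι → Fin d → ℝ}
    (hx : ∀ i, 0 ≤ x i) {i : ι} (hi : i ∈ s) {u : ℝ} (hu : 0 < u) (h : x i ∈ u • A) :
    ∑ i ∈ s, x i ∈ u • A := by
  classical
  rw [← Finset.add_sum_erase s x hi]
  exact add_mem_smul hA (Finset.sum_nonneg fun j _ => hx j) hu h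

/-- The superlevel sets are understood only on the nonnegative orthant, hence the positive part; it
changes nothing almost surely. -/
theorem measurable_setRadius_sup_zero (hA : A ∈ rareSets d) :
    Measurable fun x : Fin d → ℝ => setRadius A (x ⊔ 0) := by
  have key : ∀ u : ℝ, 0 < u → MeasurableSet {x : Fin d → ℝ | u < setRadius A (x ⊔ 0)} := by
    intro u hu
    have h1 : {x : Fin d → ℝ | u < setRadius A (x ⊔ 0)} = (fun x => x ⊔ 0) ⁻¹' (u • A) := by
      ext x
      exact lt_setRadius_iff hA le_sup_right hu
    rw [h1]
    exact (measurable_pi_lambda _ fun i => (measurable_pi_apply i).max measurable_const)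
      (hA.2.1.smul₀ hu.ne').measurableSet
  refine measurable_of_Ioi fun u => ?_
  rcases lt_trichotomy u 0 with hu | rfl | hu
  · convert MeasurableSet.univ
    ext x
    simpa using hu.trans_le (setRadius_nonneg hA le_sup_right)
  -- `lt_setRadius_iff` needs a positive level, so level `0` is reached through the levels `1 / (m +
  -- 1)`.
  · have h1 : ((fun x : Fin d → ℝ => setRadius A (x ⊔ 0)) ⁻¹' Ioi 0) =
        ⋃ m : ℕ, {x | 1 / ((m : ℝ) + 1) < setRadius A (x ⊔ 0)} := by
      ext x
      simp only [mem_preimage, mem_Ioi, mem_iUnion, mem_ofPred_eq]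
      exact ⟨exists_nat_one_div_lt, fun ⟨m, hm⟩ => lt_trans (by positivity) hm⟩
    rw [h1]
    exact MeasurableSet.iUnion fun m => key _ (by positivity)
  · exact key u hu

theorem aemeasurable_setRadius (hA : A ∈ rareSets d) {F : Measure (Fin d → ℝ)}
    (hF : ∀ᵐ x ∂F, 0 ≤ x) : AEMeasurable (setRadius A) F := by
  refine ⟨_, measurable_setRadius_sup_zero hA, ?_⟩
  filter_upwards [hF] with x hx
  rw [sup_of_le_left hx]

end Geometry

/-! ### Asymptotic comparison of functions with values in `[0, ∞]`. -/

section Asymptotics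

/-- `f` is negligible with respect to `g` at infinity, for functions with values in `[0, ∞]`. -/
def Negligible (f g : ℝ → ℝ≥0∞) : Prop :=
  ∀ ε : ℝ≥0, 0 < ε → ∀ᶠ x in atTop, f x ≤ ε * g x

theorem Negligible.trans_le {f g h : ℝ → ℝ≥0∞} (hf : Negligible f g) {K : ℝ≥0}
    (hg : ∀ᶠ x in atTop, g x ≤ K * h x) : Negligible f h := by
  intro ε hε
  have hK : 0 < K + 1 := by positivity
  filter_upwards [hf (ε / (K + 1)) (div_pos hε hK), hg] with x h1 h2
  calc f x ≤ (ε / (K + 1) : ℝ≥0) * g x := h1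
    _ ≤ (ε / (K + 1) : ℝ≥0) * ((K + 1 : ℝ≥0) * h x) := by
        gcongr
        exact h2.trans (by gcongr; simp)
    _ = ε * h x := by
        rw [← mul_assoc, ← ENNReal.coe_mul, div_mul_cancel₀ _ hK.ne']

theorem Negligible.mono_right {f g h : ℝ → ℝ≥0∞} (hf : Negligible f g) (hg : ∀ x, g x ≤ h x) :
    Negligible f h :=
  hf.trans_le (K := 1) (Eventually.of_forall fun x => by simpa using hg x)

theorem Negligible.sum {ι : Type*} {s : Finset ι} {f : ι → ℝ → ℝ≥0∞} {g : ℝ → ℝ≥0∞}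
    (hf : ∀ i ∈ s, Negligible (f i) g) : Negligible (fun x => ∑ i ∈ s, f i x) g := by
  intro ε hε
  have hK : 0 < (s.card : ℝ≥0) + 1 := by positivity
  have h1 : ∀ᶠ x in atTop, ∀ i ∈ s, f i x ≤ (ε / (s.card + 1) : ℝ≥0) * g x :=
    (Filter.eventually_all_finset s).2 fun i hi => hf i hi _ (div_pos hε hK)
  filter_upwards [h1] with x hx
  calc ∑ i ∈ s, f i x ≤ ∑ _i ∈ s, (ε / (s.card + 1) : ℝ≥0) * g x := Finset.sum_le_sum hx
    _ = ((s.card : ℝ≥0) * (ε / (s.card + 1)) : ℝ≥0) * g x := by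
        rw [Finset.sum_const, nsmul_eq_mul, ENNReal.coe_mul, mul_assoc]; simp
    _ ≤ ε * g x := by
        gcongr
        rw [mul_div_assoc', div_le_iff₀ hK, mul_comm]
        gcongr
        simp

/-- Lets later estimates lose a constant factor in `ε`; the restriction `ε ≤ 1` lets `ε ^ 2` be
absorbed into `ε`. -/
theorem eventually_le_one_add_mul {f g : ℝ → ℝ≥0∞} (K : ℝ≥0)
    (h : ∀ ε : ℝ≥0, 0 < ε → ε ≤ 1 → ∀ᶠ x in atTop, f x ≤ (1 + K * ε : ℝ≥0) * g x)
    {ε : ℝ≥0} (hε : 0 < ε) : ∀ᶠ x in atTop, f x ≤ (1 + ε : ℝ≥0) * g x := by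
  have hK : 0 < K + 1 := by positivity
  filter_upwards [h (min 1 (ε / (K + 1))) (lt_min one_pos (div_pos hε hK)) (min_le_left _ _)]
    with x hx
  refine hx.trans ?_
  gcongr
  calc K * min 1 (ε / (K + 1)) ≤ (K + 1) * (ε / (K + 1)) := by
        gcongr
        · simp
        · exact min_le_right _ _
    _ = ε := mul_div_cancel₀ _ hK.ne'

theorem tendsto_div_nhds_one {f g : ℝ → ℝ≥0∞}
    (hup : ∀ ε : ℝ≥0, 0 < ε → ∀ᶠ x in atTop, f x ≤ (1 + ε : ℝ≥0) * g x)
    (hlow : ∀ ε : ℝ≥0, 0 < ε → ∀ᶠ x in atTop, g x ≤ f x + ε * g x)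
    (hg : ∀ᶠ x in atTop, g x ≠ 0 ∧ g x ≠ ∞) :
    Tendsto (fun x => f x / g x) atTop (𝓝 1) := by
  rw [ENNReal.tendsto_nhds ENNReal.one_ne_top]
  intro δ hδ
  obtain ⟨ε, hε, hεδ⟩ : ∃ ε : ℝ≥0, 0 < ε ∧ (ε : ℝ≥0∞) ≤ δ := by
    obtain ⟨ε, h1, h2⟩ := ENNReal.lt_iff_exists_nnreal_btwn.1 hδ
    exact ⟨ε, by simpa using h1, h2.le⟩
  filter_upwards [hup ε hε, hlow ε hε, hg] with x h1 h2 ⟨h3, h4⟩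
  constructor
  · rw [tsub_le_iff_right]
    calc (1 : ℝ≥0∞) = g x / g x := (ENNReal.div_self h3 h4).symm
      _ ≤ (f x + ε * g x) / g x := by gcongr
      _ = f x / g x + ε := by
          rw [ENNReal.add_div, ENNReal.mul_div_cancel_right h3 h4]
      _ ≤ f x / g x + δ := by gcongr
  · refine ENNReal.div_le_of_le_mul (h1.trans ?_)
    gcongr
    push_cast
    gcongr

theorem eventually_le_of_tendsto_div {f g : ℝ → ℝ≥0∞} {c : ℝ≥0∞}
    (h : Tendsto (fun x => f x / g x) atTop (𝓝 c)) (hg : ∀ᶠ x in atTop, g x ≠ 0 ∧ g x ≠ ∞)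
    {c' : ℝ≥0∞} (hc : c < c') : ∀ᶠ x in atTop, f x ≤ c' * g x := by
  filter_upwards [h.eventually (gt_mem_nhds hc), hg] with x h1 ⟨h2, h3⟩
  exact (ENNReal.div_le_iff h2 h3).1 h1.le

end Asymptotics

/-! ### Eventual tail inequalities for the distribution classes. -/

section Tails

variable {V : Measure ℝ}

theorem tail_antitone (V : Measure ℝ) : Antitone (tail V) :=
  fun _ _ h => measure_mono (Ioi_subset_Ioi h)

theorem tail_ne_top [IsFiniteMeasure V] (x : ℝ) : tail V x ≠ ∞ := measure_ne_top _ _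

theorem eventually_tail_ne (hV : V ∈ positiveTail) :
    ∀ᶠ x in atTop, tail V x ≠ 0 ∧ tail V x ≠ ∞ := by
  have := hV.1
  filter_upwards [eventually_ge_atTop 0] with x hx
  exact ⟨(hV.2.2 x hx).ne', tail_ne_top x⟩

theorem eventually_tail_sub_le (hV : V ∈ longTailed) (a : ℝ) {ε : ℝ≥0} (hε : 0 < ε) :
    ∀ᶠ x in atTop, tail V (x - a) ≤ (1 + ε : ℝ≥0) * tail V x := by
  rcases le_or_gt a 0 with ha | ha
  · refine Eventually.of_forall fun x => ?_
    calc tail V (x - a) ≤ 1 * tail V x := by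
          rw [one_mul]; exact tail_antitone V (by linarith)
      _ ≤ _ := by gcongr; simp
  · refine eventually_le_of_tendsto_div (hV.2 a ha) (eventually_tail_ne hV.1) ?_
    exact_mod_cast (lt_add_iff_pos_right 1).2 hε

theorem eventually_tail_mul_le_of_dominatedlyVarying (hV : V ∈ dominatedlyVarying) {b : ℝ}
    (hb : 0 < b) (hb1 : b < 1) : ∃ K : ℝ≥0, ∀ᶠ x in atTop, tail V (b * x) ≤ K * tail V x := by
  obtain ⟨K, hK, -⟩ := ENNReal.lt_iff_exists_nnreal_btwn.1 (hV.2 b hb hb1)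
  refine ⟨K, ?_⟩
  filter_upwards [eventually_lt_of_limsup_lt hK, eventually_tail_ne hV.1] with x h1 ⟨h2, h3⟩
  exact (ENNReal.div_le_iff h2 h3).1 h1.le

theorem eventually_eventually_tail_mul_le (hV : V ∈ consistentlyVarying) {ε : ℝ≥0} (hε : 0 < ε) :
    ∀ᶠ b in 𝓝[<] 1, ∀ᶠ x in atTop, tail V (b * x) ≤ (1 + ε : ℝ≥0) * tail V x := by
  have h1 : (1 : ℝ≥0∞) < (1 + ε : ℝ≥0) := by exact_mod_cast (lt_add_iff_pos_right 1).2 hε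
  filter_upwards [hV.2.eventually (gt_mem_nhds h1)] with b hb
  filter_upwards [eventually_lt_of_limsup_lt hb, eventually_tail_ne hV.1] with x h1 ⟨h2, h3⟩
  exact (ENNReal.div_le_iff h2 h3).1 h1.le

/-- A single `c < 1` at which scaling costs at most a factor `2` suffices: iterating it `k` times
with `c ^ k < b` costs `2 ^ k`. -/
theorem consistentlyVarying_subset : consistentlyVarying ⊆ dominatedlyVarying := by
  intro V hV
  refine ⟨hV.1, fun b hb hb1 => ?_⟩
  obtain ⟨c, hc, hc0, hc1⟩ := ((eventually_eventually_tail_mul_le hV (ε := 1) one_pos).and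
    (Ioo_mem_nhdsLT (zero_lt_one' ℝ))).exists
  have key : ∀ k : ℕ, ∀ᶠ x in atTop, tail V (c ^ k * x) ≤ (2 : ℝ≥0) ^ k * tail V x := by
    intro k
    induction k with
    | zero => simp
    | succ k ih =>
      filter_upwards [(tendsto_id.const_mul_atTop hc0).eventually ih, hc] with x h1 h2
      calc tail V (c ^ (k + 1) * x) = tail V (c ^ k * (c * x)) := by ring_nf
        _ ≤ (2 : ℝ≥0) ^ k * tail V (c * x) := h1
        _ ≤ (2 : ℝ≥0) ^ k * ((1 + 1 : ℝ≥0) * tail V x) := by gcongr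
        _ = (2 : ℝ≥0) ^ (k + 1) * tail V x := by
          rw [one_add_one_eq_two, pow_succ, mul_assoc]
  obtain ⟨k, hk⟩ := exists_pow_lt_of_lt_one hb hc1
  refine lt_of_le_of_lt (limsup_le_of_le (a := (2 : ℝ≥0∞) ^ k) (by isBoundedDefault) ?_)
    (by simp)
  filter_upwards [key k, eventually_tail_ne hV.1, eventually_ge_atTop 0] with x h1 ⟨h2, h3⟩ h4
  rw [ENNReal.div_le_iff h2 h3]
  refine (tail_antitone V ?_).trans (by simpa using h1)
  gcongr

end Tails

/-! ### A Bonferroni lower bound for unions. -/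

section Union

theorem sum_measure_le_measure_iUnion_add {Ω ι : Type*} [MeasurableSpace Ω] [Fintype ι]
    [DecidableEq ι] (P : Measure Ω) {E : ι → Set Ω} (hE : ∀ i, NullMeasurableSet (E i) P) :
    ∑ i, P (E i) ≤ P (⋃ i, E i) + ∑ i, ∑ j ∈ Finset.univ.erase i, P (E i ∩ E j) := by
  -- The parts of the events where exactly one occurs are disjoint; what each event loses is covered
  -- by its pairwise intersections.
  set B : ι → Set Ω := fun i => E i \ ⋃ j ∈ Finset.univ.erase i, E j with hB
  have hBm : ∀ i, NullMeasurableSet (B i) P := fun i =>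
    (hE i).diff (Finset.nullMeasurableSet_biUnion _ fun j _ => hE j)
  have hdisj : Pairwise (Function.onFun Disjoint B) := by
    intro i j hij
    refine Set.disjoint_left.2 fun ω hi hj => hj.2 ?_
    exact mem_biUnion (by simpa using hij) hi.1
  have h1 : ∑ i, P (B i) ≤ P (⋃ i, E i) := by
    rw [← tsum_fintype (L := .unconditional ι),
      ← measure_iUnion₀ (fun i j h => (hdisj h).aedisjoint) hBm]
    exact measure_mono (iUnion_mono fun i => sdiff_subset)
  have h2 : ∀ i, P (E i) ≤ P (B i) + ∑ j ∈ Finset.univ.erase i, P (E i ∩ E j) := by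
    intro i
    calc P (E i) ≤ P (B i ∪ ⋃ j ∈ Finset.univ.erase i, E i ∩ E j) := by
          refine measure_mono fun ω hω => ?_
          by_cases h : ω ∈ ⋃ j ∈ Finset.univ.erase i, E j
          · right
            obtain ⟨j, hj, hωj⟩ := mem_iUnion₂.1 h
            exact mem_iUnion₂.2 ⟨j, hj, hω, hωj⟩
          · exact Or.inl ⟨hω, h⟩
      _ ≤ _ := (measure_union_le _ _).trans (by gcongr; exact measure_biUnion_finset_le _ _)
  calc ∑ i, P (E i) ≤ ∑ i, (P (B i) + ∑ j ∈ Finset.univ.erase i, P (E i ∩ E j)) :=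
        Finset.sum_le_sum fun i _ => h2 i
    _ ≤ _ := by rw [Finset.sum_add_distrib]; gcongr

end Union

/-! ### Both of two independent variables large, with a large sum. -/

section JointTail

/-- The probability that two independent random variables with laws `F` and `G` both exceed `b`
and have a sum exceeding `x`. -/
noncomputable def jointTail (F G : Measure ℝ) (x b : ℝ) : ℝ≥0∞ :=
  (F.prod G) {p | x < p.1 + p.2 ∧ b < p.1 ∧ b < p.2}

theorem measurableSet_jointTail (x b : ℝ) :
    MeasurableSet {p : ℝ × ℝ | x < p.1 + p.2 ∧ b < p.1 ∧ b < p.2} :=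
  (measurableSet_lt measurable_const (measurable_fst.add measurable_snd)).inter
    ((measurableSet_lt measurable_const measurable_fst).inter
      (measurableSet_lt measurable_const measurable_snd))

theorem measurable_indicator_tail (G : Measure ℝ) (x b : ℝ) :
    Measurable ((Ioi b).indicator fun s => tail G (max (x - s) b)) := by
  refine Measurable.indicator ?_ measurableSet_Ioi
  exact (tail_antitone G).measurable.comp
    ((measurable_const.sub measurable_id).max measurable_const)

theorem jointTail_eq_lintegral (F G : Measure ℝ) [SFinite G] (x b : ℝ) :
    jointTail F G x b = ∫⁻ s, (Ioi b).indicator (fun s => tail G (max (x - s) b)) s ∂F := by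
  rw [jointTail, Measure.prod_apply (measurableSet_jointTail x b)]
  refine lintegral_congr fun s => ?_
  by_cases hs : b < s
  · rw [indicator_of_mem (mem_Ioi.2 hs)]
    refine congrArg G (Set.ext fun t => ?_)
    simp [hs, sub_lt_iff_lt_add']
  · rw [indicator_of_notMem (by simpa using hs)]
    convert measure_empty (μ := G)
    ext t
    simp [hs]

theorem jointTail_comm (F G : Measure ℝ) [SFinite F] [SFinite G] (x b : ℝ) :
    jointTail F G x b = jointTail G F x b := by
  rw [jointTail, jointTail, ← Measure.prod_swap,
    Measure.map_apply measurable_swap (measurableSet_jointTail x b)]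
  congr 1
  ext p
  simp [add_comm, and_comm]

/-- Conditioning on the first variable evaluates the tail of `G` only at points `max (x - s) b`, so
a comparison beyond `b` is enough. -/
theorem jointTail_le_sum {F G : Measure ℝ} [SFinite G] {ι : Type*} {J : Finset ι}
    {H : ι → Measure ℝ} [∀ j, SFinite (H j)] {c : ℝ≥0} {b : ℝ}
    (h : ∀ t, b ≤ t → tail G t ≤ c * ∑ j ∈ J, tail (H j) t) (x : ℝ) :
    jointTail F G x b ≤ c * ∑ j ∈ J, jointTail F (H j) x b := by
  simp_rw [jointTail_eq_lintegral]
  rw [← lintegral_finsetSum _ fun j _ => measurable_indicator_tail (H j) x b,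
    ← lintegral_const_mul _ (Finset.measurable_fun_sum _ fun j _ =>
      measurable_indicator_tail (H j) x b)]
  refine lintegral_mono fun s => ?_
  by_cases hs : b < s
  · simp only [indicator_of_mem (mem_Ioi.2 hs)]
    exact h _ (le_max_right _ _)
  · simp [indicator_of_notMem (show s ∉ Ioi b by simpa using hs)]

theorem jointTail_mono {F G H : Measure ℝ} [SFinite G] [SFinite H]
    (h : ∀ t, tail G t ≤ tail H t) (x b : ℝ) : jointTail F G x b ≤ jointTail F H x b := by
  simpa using jointTail_le_sum (F := F) (J := ({()} : Finset Unit)) (H := fun _ => H) (c := 1)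
    (b := b) (fun t _ => by simpa using h t) x

end JointTail

/-! ### Subexponential laws: long tails and smallness of the joint tail. -/

section Subexponential

variable {V F G : Measure ℝ}

theorem tail_conv (F G : Measure ℝ) (x : ℝ) :
    tail (F.conv G) x = (F.prod G) {p | x < p.1 + p.2} :=
  Measure.map_apply (measurable_fst.add measurable_snd) measurableSet_Ioi

theorem tail_le_tail_conv [IsProbabilityMeasure F] [IsProbabilityMeasure G] (hG : G (Iio 0) = 0)
    (x : ℝ) : tail F x ≤ tail (F.conv G) x := by
  have h1 : G (Ici 0) = 1 := by
    rw [← compl_Iio, prob_compl_eq_one_iff measurableSet_Iio, hG]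
  calc tail F x = (F.prod G) (Ioi x ×ˢ Ici 0) := by rw [Measure.prod_prod, h1, mul_one, tail]
    _ ≤ tail (F.conv G) x := by
      rw [tail_conv]
      refine measure_mono fun p hp => ?_
      have h1 : x < p.1 := hp.1
      have h2 : 0 ≤ p.2 := hp.2
      exact lt_add_of_lt_of_nonneg h1 h2

theorem measure_Icc_zero_add_tail (hV : V ∈ positiveTail) {b : ℝ} (hb : 0 ≤ b) :
    V (Icc 0 b) + tail V b = 1 := by
  have := hV.1
  rw [tail, ← measure_union ((Iic_disjoint_Ioi le_rfl).mono_left Icc_subset_Iic_self)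
    measurableSet_Ioi, Icc_union_Ioi_eq_Ici hb, ← compl_Iio,
    prob_compl_eq_one_iff measurableSet_Iio, hV.2.1]

theorem tendsto_tail_atTop [IsFiniteMeasure V] : Tendsto (tail V) atTop (𝓝 0) := by
  have h := tendsto_measure_iInter_atTop (μ := V) (s := fun x : ℝ => Ioi x)
    (fun _ => measurableSet_Ioi.nullMeasurableSet) (fun _ _ h => Ioi_subset_Ioi h)
    ⟨0, measure_ne_top _ _⟩
  have h2 : ⋂ x : ℝ, Ioi x = ∅ := by
    refine eq_empty_of_forall_notMem fun y hy => ?_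
    exact lt_irrefl y (mem_iInter.1 hy y)
  rwa [h2, measure_empty] at h

theorem eventually_tail_conv_self_le (hV : V ∈ subexponential) {ε : ℝ≥0} (hε : 0 < ε) :
    ∀ᶠ x in atTop, tail (V.conv V) x ≤ (2 + ε : ℝ≥0) * tail V x := by
  have := hV.1.1
  have h2 := hV.2 2 le_rfl
  have h3 : convPow V 2 = V.conv V := by
    simp only [convPow, Measure.dirac_zero_conv]
  rw [h3] at h2
  refine eventually_le_of_tendsto_div h2 (eventually_tail_ne hV.1) ?_
  exact_mod_cast (lt_add_iff_pos_right (2 : ℝ≥0)).2 hε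

/-- Three disjoint regions of `s + t > x` are weighed: `s > x`; `s ≤ a` with `t > x`; `a < s ≤ x`
with `t > x - a`. The first two have total mass nearly `2 - V(a, ∞)` times the tail at `x`, and the
whole at most `2 + ε` times it, so the third forces the tail at `x - a` down to that at `x`. -/
theorem subexponential_subset_longTailed : subexponential ⊆ longTailed := by
  intro V hV
  have := hV.1.1
  refine ⟨hV.1, fun a ha => ?_⟩
  set α := (tail V a).toReal with hα
  have hα0 : 0 < α := ENNReal.toReal_pos (hV.1.2.2 a ha.le).ne' (tail_ne_top a)
  refine tendsto_div_nhds_one (fun δ hδ => ?_) (fun ε _ => Eventually.of_forall fun x => ?_)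
    (eventually_tail_ne hV.1)
  -- Chosen so that `(α / 2) * (u - w) ≤ 2 * ε * w` gives `u - w ≤ δ * w`.
  · set ε : ℝ := δ * α / 4 with hε
    have hδ' : (0 : ℝ) < δ := hδ
    have hε0 : 0 < ε := by positivity
    have hlim : Tendsto (fun x => (tail V x).toReal) atTop (𝓝 0) := 
      (ENNReal.tendsto_toReal ENNReal.zero_ne_top).comp (tendsto_tail_atTop (V := V))
    filter_upwards [eventually_tail_conv_self_le hV (ε := ε.toNNReal) (by simpa using hε0),
      hlim.eventually (gt_mem_nhds hε0), hlim.eventually (gt_mem_nhds (half_pos hα0)),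
      eventually_ge_atTop a] with x h1 h2 h3 hxa
    have hsub : (Ioi x ×ˢ Ici 0 ∪ Icc 0 a ×ˢ Ioi x) ∪ Ioc a x ×ˢ Ioi (x - a) ⊆
        {p : ℝ × ℝ | x < p.1 + p.2} := by
      rintro ⟨s, t⟩ ((⟨h, h'⟩ | ⟨h, h'⟩) | ⟨h, h'⟩) <;>
        simp only [mem_Ioi, mem_Ici, mem_Icc, mem_Ioc, mem_ofPred_eq] at h h' ⊢ <;> linarith
    have hd1 : Disjoint (Ioi x ×ˢ Ici (0 : ℝ)) (Icc 0 a ×ˢ Ioi x) :=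
      Set.disjoint_left.2 fun p h h' => not_lt.2 (h'.1.2.trans hxa) h.1
    have hd2 : Disjoint (Ioi x ×ˢ Ici 0 ∪ Icc 0 a ×ˢ Ioi x) (Ioc a x ×ˢ Ioi (x - a)) :=
      Set.disjoint_left.2 fun p h h' => h.elim (fun h => not_lt.2 h'.1.2 h.1)
        fun h => not_lt.2 h.1.2 h'.1.1
    have h4 : V (Ici 0) = 1 := by
      rw [← compl_Iio, prob_compl_eq_one_iff measurableSet_Iio, hV.1.2.1]
    have h5 : tail V x + V (Icc 0 a) * tail V x + V (Ioc a x) * tail V (x - a) ≤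
        (2 + ε.toNNReal : ℝ≥0) * tail V x := by
      refine le_trans ?_ h1
      rw [tail_conv]
      refine le_trans (le_of_eq ?_) (measure_mono hsub)
      rw [measure_union hd2 (measurableSet_Ioc.prod measurableSet_Ioi),
        measure_union hd1 (measurableSet_Icc.prod measurableSet_Ioi), Measure.prod_prod,
        Measure.prod_prod, Measure.prod_prod, h4, mul_one]
      rfl
    have h6 := measure_Icc_zero_add_tail hV.1 ha.le
    have h7 : V (Ioc a x) + tail V x = tail V a := by
      rw [tail, ← measure_union ((Iic_disjoint_Ioi le_rfl).mono_left Ioc_subset_Iic_self)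
        measurableSet_Ioi, Ioc_union_Ioi_eq_Ioi hxa, tail]
    have h8 : tail V x ≤ tail V (x - a) := tail_antitone V (by linarith)
    have e1 : tail V x ≠ ∞ := tail_ne_top x
    have e2 : tail V (x - a) ≠ ∞ := tail_ne_top _
    have e3 : V (Icc 0 a) ≠ ∞ := measure_ne_top _ _
    have e4 : V (Ioc a x) ≠ ∞ := measure_ne_top _ _
    have e5 : tail V a ≠ ∞ := tail_ne_top a
    set w := (tail V x).toReal with hw
    set u := (tail V (x - a)).toReal with hu
    have h5' : w + (V (Icc 0 a)).toReal * w + (V (Ioc a x)).toReal * u ≤ (2 + ε) * w := by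
      have := ENNReal.toReal_mono (ENNReal.mul_ne_top ENNReal.coe_ne_top e1) h5
      rw [ENNReal.toReal_add (by finiteness) (by finiteness), ENNReal.toReal_add e1 (by finiteness),
        ENNReal.toReal_mul, ENNReal.toReal_mul, ENNReal.toReal_mul, ENNReal.coe_toReal,
        NNReal.coe_add, Real.coe_toNNReal _ hε0.le] at this
      exact this
    have h6' : (V (Icc 0 a)).toReal + α = 1 := by
      rw [hα, ← ENNReal.toReal_add e3 e5, h6, ENNReal.toReal_one]
    have h7' : (V (Ioc a x)).toReal + w = α := by
      rw [hα, ← ENNReal.toReal_add e4 e1, h7]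
    have h8' : w ≤ u := ENNReal.toReal_mono e2 h8
    have hw0 : 0 ≤ w := ENNReal.toReal_nonneg
    have h9 : u ≤ (1 + δ) * w := by
      have e6 : (V (Icc 0 a)).toReal = 1 - α := by linarith
      have e7 : (V (Ioc a x)).toReal = α - w := by linarith
      rw [e6, e7] at h5'
      have e8 : (α / 2) * (u - w) ≤ (α - w) * (u - w) :=
        mul_le_mul_of_nonneg_right (by linarith) (by linarith)
      have e9 : w * w ≤ ε * w := mul_le_mul_of_nonneg_right h2.le hw0
      have e10 : (α / 2) * (u - w) ≤ (α / 2) * (δ * w) := by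
        calc (α / 2) * (u - w) ≤ 2 * ε * w := by linarith
          _ = (α / 2) * (δ * w) := by rw [hε]; ring
      have := le_of_mul_le_mul_left e10 (half_pos hα0)
      linarith
    rw [← ENNReal.toReal_le_toReal e2 (by finiteness), ENNReal.toReal_mul,
      ENNReal.coe_toReal]
    exact h9
  · exact (tail_antitone V (by linarith)).trans le_self_add

/-- The strips where one variable is at most `b` and the other exceeds `x` already carry nearly all
of the mass `2 * tail V x` of the convolution tail. -/
theorem eventually_jointTail_self_le (hV : V ∈ subexponential) {ε : ℝ≥0} (hε : 0 < ε) :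
    ∀ᶠ b in atTop, ∀ᶠ x in atTop, jointTail V V x b ≤ ε * tail V x := by
  have := hV.1.1
  have hε3 : 0 < ε / 3 := by positivity
  have h1 : ∀ᶠ b in atTop, tail V b < (ε / 3 : ℝ≥0) :=
    tendsto_tail_atTop.eventually (gt_mem_nhds (by exact_mod_cast hε3))
  filter_upwards [h1, eventually_ge_atTop 0] with b hb hb0
  filter_upwards [eventually_tail_conv_self_le hV hε3, eventually_ge_atTop b] with x hx hxb
  have hsub : ({p : ℝ × ℝ | x < p.1 + p.2 ∧ b < p.1 ∧ b < p.2} ∪ Icc 0 b ×ˢ Ioi x) ∪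
      Ioi x ×ˢ Icc 0 b ⊆ {p : ℝ × ℝ | x < p.1 + p.2} := by
    rintro ⟨s, t⟩ ((⟨h, h'⟩ | ⟨h, h'⟩) | ⟨h, h'⟩)
    · exact h
    all_goals simp only [mem_Ioi, mem_Icc, mem_ofPred_eq] at h h' ⊢; linarith
  have hd1 : Disjoint {p : ℝ × ℝ | x < p.1 + p.2 ∧ b < p.1 ∧ b < p.2} (Icc 0 b ×ˢ Ioi x) :=
    Set.disjoint_left.2 fun p h h' => not_lt.2 h'.1.2 h.2.1
  have hd2 : Disjoint ({p : ℝ × ℝ | x < p.1 + p.2 ∧ b < p.1 ∧ b < p.2} ∪ Icc 0 b ×ˢ Ioi x)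
      (Ioi x ×ˢ Icc 0 b) :=
    Set.disjoint_left.2 fun p h h' => h.elim (fun h => not_lt.2 h'.2.2 h.2.2)
      fun h => not_lt.2 (h.1.2.trans hxb) h'.1
  have h2 : jointTail V V x b + V (Icc 0 b) * tail V x + tail V x * V (Icc 0 b) ≤
      (2 + ε / 3 : ℝ≥0) * tail V x := by
    refine le_trans ?_ hx
    rw [tail_conv]
    refine le_trans (le_of_eq ?_) (measure_mono hsub)
    rw [measure_union hd2 (measurableSet_Ioi.prod measurableSet_Icc),
      measure_union hd1 (measurableSet_Icc.prod measurableSet_Ioi), Measure.prod_prod,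
      Measure.prod_prod]
    rfl
  have h3 : (1 : ℝ≥0∞) ≤ V (Icc 0 b) + (ε / 3 : ℝ≥0) :=
    (measure_Icc_zero_add_tail hV.1 hb0).ge.trans (by gcongr)
  have e1 : tail V x ≠ ∞ := tail_ne_top x
  have h4 : 2 * tail V x + jointTail V V x b ≤ 2 * tail V x + ε * tail V x := by
    calc 2 * tail V x + jointTail V V x b
        ≤ 2 * ((V (Icc 0 b) + (ε / 3 : ℝ≥0)) * tail V x) + jointTail V V x b := by
          gcongr
          calc tail V x = 1 * tail V x := (one_mul _).symm
            _ ≤ _ := by gcongr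
      _ = (jointTail V V x b + V (Icc 0 b) * tail V x + tail V x * V (Icc 0 b)) +
          2 * (ε / 3 : ℝ≥0) * tail V x := by ring
      _ ≤ (2 + ε / 3 : ℝ≥0) * tail V x + 2 * (ε / 3 : ℝ≥0) * tail V x := by gcongr
      _ = 2 * tail V x + ((ε / 3 + 2 * (ε / 3) : ℝ≥0) : ℝ≥0∞) * tail V x := by
          push_cast; ring
      _ = 2 * tail V x + ε * tail V x := by
          congr 3
          ring
  exact (ENNReal.add_le_add_iff_left (by finiteness)).1 h4

/-- The convolution `H = F * G` has a heavier tail than both factors, so the joint tail of `F`, `G`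
is at most that of `H`, `H`, which is at most `δ * tail H x`. Long tails bound `tail H x` by this
joint tail plus about `tail F x + tail G x`; as `δ ≤ 1 / 2`, the joint term is absorbed. -/
theorem eventually_jointTail_le (hF : F ∈ longTailed) (hG : G ∈ longTailed)
    (hFG : F.conv G ∈ subexponential) {ε : ℝ≥0} (hε : 0 < ε) :
    ∀ᶠ b in atTop, ∀ᶠ x in atTop, jointTail F G x b ≤ ε * (tail F x + tail G x) := by
  have := hF.1.1
  have := hG.1.1
  have := hFG.1.1
  set δ : ℝ≥0 := min (1 / 2) (ε / 4) with hδ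
  have hδ0 : 0 < δ := by positivity
  have hFH : ∀ t, tail F t ≤ tail (F.conv G) t := tail_le_tail_conv hG.1.2.1
  have hGH : ∀ t, tail G t ≤ tail (F.conv G) t := fun t => by
    rw [Measure.conv_comm]
    exact tail_le_tail_conv hF.1.2.1 t
  filter_upwards [eventually_jointTail_self_le hFG hδ0] with b hb
  filter_upwards [hb, eventually_tail_sub_le hF b one_pos, eventually_tail_sub_le hG b one_pos]
    with x h1 h2 h3
  have h4 : jointTail F G x b ≤ δ * tail (F.conv G) x := by
    calc jointTail F G x b ≤ jointTail F (F.conv G) x b := jointTail_mono hGH x b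
      _ = jointTail (F.conv G) F x b := jointTail_comm _ _ _ _
      _ ≤ jointTail (F.conv G) (F.conv G) x b := jointTail_mono hFH x b
      _ ≤ _ := h1
  have h5 : tail (F.conv G) x ≤ jointTail F G x b + tail F (x - b) + tail G (x - b) := by
    have e1 : tail F (x - b) = (F.prod G) (Ioi (x - b) ×ˢ univ) := by
      rw [Measure.prod_prod, measure_univ, mul_one, tail]
    have e2 : tail G (x - b) = (F.prod G) (univ ×ˢ Ioi (x - b)) := by
      rw [Measure.prod_prod, measure_univ, one_mul, tail]
    rw [tail_conv, e1, e2, jointTail]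
    refine le_trans (measure_mono ?_) ((measure_union_le _ _).trans
      (by gcongr; exact measure_union_le _ _))
    rintro ⟨s, t⟩ h
    simp only [mem_ofPred_eq] at h
    by_cases hs : b < s
    · by_cases ht : b < t
      · exact Or.inl (Or.inl ⟨h, hs, ht⟩)
      · exact Or.inl (Or.inr ⟨by simp only [mem_Ioi]; linarith, mem_univ _⟩)
    · exact Or.inr ⟨mem_univ _, by simp only [mem_Ioi]; linarith⟩
  have h6 : tail (F.conv G) x ≤ 4 * (tail F x + tail G x) := by
    have e1 : tail (F.conv G) x ≤
        2⁻¹ * tail (F.conv G) x + 2 * (tail F x + tail G x) := by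
      calc tail (F.conv G) x ≤ jointTail F G x b + tail F (x - b) + tail G (x - b) := h5
        _ ≤ δ * tail (F.conv G) x + (1 + 1 : ℝ≥0) * tail F x + (1 + 1 : ℝ≥0) * tail G x := by
          gcongr
        _ = δ * tail (F.conv G) x + 2 * (tail F x + tail G x) := by
          rw [one_add_one_eq_two, ENNReal.coe_ofNat]; ring
        _ ≤ _ := by
          gcongr
          calc (δ : ℝ≥0∞) ≤ ((1 / 2 : ℝ≥0) : ℝ≥0∞) := by gcongr; exact min_le_left _ _
            _ = 2⁻¹ := by simp
    have e2 : 2⁻¹ * tail (F.conv G) x + 2⁻¹ * tail (F.conv G) x ≤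
        2⁻¹ * tail (F.conv G) x + 2 * (tail F x + tail G x) := by
      rwa [← add_mul, ENNReal.inv_two_add_inv_two, one_mul]
    have e3 := (ENNReal.add_le_add_iff_left (ENNReal.mul_ne_top (by simp) (tail_ne_top x))).1 e2
    calc tail (F.conv G) x = 2 * (2⁻¹ * tail (F.conv G) x) := by
          rw [← mul_assoc, ENNReal.mul_inv_cancel (by simp) (by simp), one_mul]
      _ ≤ 2 * (2 * (tail F x + tail G x)) := by gcongr
      _ = 4 * (tail F x + tail G x) := by rw [← mul_assoc]; norm_num
  calc jointTail F G x b ≤ δ * tail (F.conv G) x := h4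
    _ ≤ (ε / 4 : ℝ≥0) * (4 * (tail F x + tail G x)) := by
        gcongr
        exact min_le_right _ _
    _ = ((ε / 4 * 4 : ℝ≥0) : ℝ≥0∞) * (tail F x + tail G x) := by push_cast; ring
    _ = ε * (tail F x + tail G x) := by rw [div_mul_cancel₀ _ (by norm_num)]

end Subexponential

/-! ### Upper bounds under quasi- and tail asymptotic independence. -/

section RandomVariables

variable {Ω : Type*} [MeasurableSpace Ω] {P : Measure Ω} {n : ℕ} {Y : Fin n → Ω → ℝ}

theorem tail_map {Z : Ω → ℝ} (hZ : AEMeasurable Z P) (x : ℝ) :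
    tail (P.map Z) x = P {ω | x < Z ω} :=
  Measure.map_apply_of_aemeasurable hZ measurableSet_Ioi

theorem tail_le_sum_tail (F : Fin n → Measure ℝ) (i : Fin n) (x : ℝ) :
    tail (F i) x ≤ ∑ j, tail (F j) x :=
  Finset.single_le_sum (f := fun j => tail (F j) x) (fun _ _ => zero_le) (Finset.mem_univ i)

/-- If a sum of numbers exceeds `x`, then one of them exceeds `x - s`, or two of them
are large. -/
theorem exists_lt_or_exists_lt_lt (hn : 1 ≤ n) {y : Fin n → ℝ} {x s : ℝ}
    (hs : 0 ≤ s) (h : x < ∑ i, y i) :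
    (∃ i, x - s < y i) ∨ ∃ i, ∃ j ∈ Finset.univ.erase i, x / n < y i ∧ s / n < y j := by
  have hn' : (0 : ℝ) < n := by exact_mod_cast hn
  obtain ⟨i, -, hi⟩ : ∃ i ∈ Finset.univ, x / n < y i := by
    refine Finset.exists_lt_of_sum_lt ?_
    simpa [mul_div_cancel₀ _ hn'.ne'] using h
  by_cases hxi : x - s < y i
  · exact Or.inl ⟨i, hxi⟩
  refine Or.inr ⟨i, ?_⟩
  by_contra! hcon
  have h1 : ∑ j ∈ Finset.univ.erase i, y j ≤ ∑ _j ∈ Finset.univ.erase i, s / n :=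
    Finset.sum_le_sum fun j hj => hcon j hj hi
  have h2 : ∑ _j ∈ Finset.univ.erase i, s / n ≤ ∑ _j : Fin n, s / n :=
    Finset.sum_le_sum_of_subset_of_nonneg (Finset.erase_subset _ _) fun _ _ _ => by positivity
  have h3 : ∑ _j : Fin n, s / n = s := by
    simp [mul_div_cancel₀ _ hn'.ne']
  rw [← Finset.add_sum_erase _ y (Finset.mem_univ i)] at h
  linarith

theorem measure_lt_sum_le (hY : ∀ i, AEMeasurable (Y i) P) {x s : ℝ} (hs : 0 ≤ s) (hn : 1 ≤ n) :
    P {ω | x < ∑ i, Y i ω} ≤ ∑ i, tail (P.map (Y i)) (x - s) +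
      ∑ i, ∑ j ∈ Finset.univ.erase i, P {ω | x / n < Y i ω ∧ s / n < Y j ω} := by
  simp_rw [fun i => tail_map (hY i)]
  calc P {ω | x < ∑ i, Y i ω} ≤ P ((⋃ i, {ω | x - s < Y i ω}) ∪
        ⋃ i, ⋃ j ∈ Finset.univ.erase i, {ω | x / n < Y i ω ∧ s / n < Y j ω}) := by
        refine measure_mono fun ω hω => ?_
        rcases exists_lt_or_exists_lt_lt hn hs hω with ⟨i, hi⟩ | ⟨i, j, hj, hij⟩
        · exact Or.inl (mem_iUnion.2 ⟨i, hi⟩)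
        · exact Or.inr (mem_iUnion.2 ⟨i, mem_iUnion₂.2 ⟨j, hj, hij⟩⟩)
    _ ≤ _ := by
        refine (measure_union_le _ _).trans (add_le_add (measure_iUnion_fintype_le _ _) ?_)
        refine (measure_iUnion_fintype_le _ _).trans (Finset.sum_le_sum fun i _ => ?_)
        exact measure_biUnion_finset_le _ _

theorem QAI.negligible (h : QAI P Y) (hY : ∀ i, AEMeasurable (Y i) P)
    (hF : ∀ i, P.map (Y i) ∈ positiveTail) {i j : Fin n} (hij : i ≠ j) :
    Negligible (fun x => P {ω | x < Y i ω ∧ x < Y j ω})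
      (fun x => tail (P.map (Y i)) x + tail (P.map (Y j)) x) := by
  intro ε hε
  have h1 := h i j hij
  simp_rw [← fun i => tail_map (hY i)] at h1
  refine eventually_le_of_tendsto_div h1 ?_ (by exact_mod_cast hε)
  filter_upwards [eventually_tail_ne (hF i), eventually_tail_ne (hF j)] with x h2 h3
  exact ⟨by simp [h2.1], ENNReal.add_ne_top.2 ⟨h2.2, h3.2⟩⟩

theorem exists_eventually_sum_tail_mul_le {F : Fin n → Measure ℝ}
    (hF : ∀ i, F i ∈ dominatedlyVarying) {b : ℝ} (hb : 0 < b) (hb1 : b < 1) :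
    ∃ K : ℝ≥0, ∀ᶠ x in atTop, ∀ i, tail (F i) (b * x) ≤ K * tail (F i) x := by
  choose K hK using fun i => eventually_tail_mul_le_of_dominatedlyVarying (hF i) hb hb1
  refine ⟨∑ i, K i, ?_⟩
  filter_upwards [eventually_all.2 hK] with x hx i
  refine (hx i).trans ?_
  gcongr
  exact Finset.single_le_sum (f := K) (fun _ _ => zero_le) (Finset.mem_univ i)

theorem eventually_measure_lt_sum_le_of_QAI (hn : 1 ≤ n) (hY : ∀ i, AEMeasurable (Y i) P)
    (hF : ∀ i, P.map (Y i) ∈ consistentlyVarying)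
    (hQ : QAI P Y) {ε : ℝ≥0} (hε : 0 < ε) :
    ∀ᶠ x in atTop, P {ω | x < ∑ i, Y i ω} ≤ (1 + ε : ℝ≥0) * ∑ i, tail (P.map (Y i)) x := by
  refine eventually_le_one_add_mul 2 (fun ε hε _ => ?_) hε
  have hn' : (1 : ℝ) ≤ n := by exact_mod_cast hn
  obtain ⟨b, hb, hb0, hb1⟩ := ((eventually_all.2 fun i =>
    eventually_eventually_tail_mul_le (hF i) hε).and (Ioo_mem_nhdsLT (zero_lt_one' ℝ))).exists
  -- With `s = (1 - b) * x`, the single-jump level is `b * x`, and `c * x` lies below both pair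
  -- levels `x / n` and `s / n`.
  set c : ℝ := (1 - b) / n with hc
  have hc0 : 0 < c := div_pos (by linarith) (by linarith)
  have hc1 : c < 1 := (div_lt_one (by linarith)).2 (by linarith)
  obtain ⟨K, hK⟩ := exists_eventually_sum_tail_mul_le (fun i => consistentlyVarying_subset (hF i))
    hc0 hc1
  have hneg : Negligible (fun x => ∑ i, ∑ j ∈ Finset.univ.erase i,
      P {ω | c * x < Y i ω ∧ c * x < Y j ω}) (fun x => ∑ i, tail (P.map (Y i)) x) := by
    refine Negligible.sum fun i _ => Negligible.sum fun j hj => ?_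
    have h1 : Negligible (fun x => P {ω | c * x < Y i ω ∧ c * x < Y j ω})
        (fun x => tail (P.map (Y i)) (c * x) + tail (P.map (Y j)) (c * x)) := fun ε hε =>
      (tendsto_id.const_mul_atTop hc0).eventually
        (hQ.negligible hY (fun i => (hF i).1) (Finset.ne_of_mem_erase hj).symm ε hε)
    refine h1.trans_le (K := K + K) ?_
    filter_upwards [hK] with x hx
    rw [ENNReal.coe_add, add_mul]
    refine add_le_add ((hx i).trans ?_) ((hx j).trans ?_) <;> gcongr <;>
      exact tail_le_sum_tail (fun i => P.map (Y i)) _ x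
  filter_upwards [hneg ε hε, eventually_all.2 hb, eventually_ge_atTop 0] with x h1 h2 hx0
  have hs : 0 ≤ (1 - b) * x := mul_nonneg (by linarith) hx0
  have e1 : (1 - b) * x / n = c * x := by rw [hc]; ring
  have e2 : x - (1 - b) * x = b * x := by ring
  have e3 : c * x ≤ x / n := by
    rw [← e1]
    gcongr
    nlinarith
  calc P {ω | x < ∑ i, Y i ω} ≤ _ := measure_lt_sum_le hY hs hn
    _ ≤ ∑ i, (1 + ε : ℝ≥0) * tail (P.map (Y i)) x + ε * ∑ i, tail (P.map (Y i)) x := by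
        rw [e1, e2]
        refine add_le_add (Finset.sum_le_sum fun i _ => h2 i) (le_trans ?_ h1)
        refine Finset.sum_le_sum fun i _ => Finset.sum_le_sum fun j _ => measure_mono ?_
        exact fun ω h => ⟨e3.trans_lt h.1, h.2⟩
    _ = (1 + 2 * ε : ℝ≥0) * ∑ i, tail (P.map (Y i)) x := by
        rw [← Finset.mul_sum, ← add_mul]
        congr 1
        push_cast
        ring

theorem TAI.eventually_measure_le [IsFiniteMeasure P] (h : TAI P Y)
    (hY : ∀ i, AEMeasurable (Y i) P) {i j : Fin n}
    (hij : i ≠ j) {ε : ℝ≥0} (hε : 0 < ε) :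
    ∀ᶠ p : ℝ × ℝ in atTop ×ˢ atTop, P {ω | p.2 < Y i ω ∧ p.1 < Y j ω} ≤
      ε * tail (P.map (Y i)) p.2 := by
  have h1 := (h j i hij.symm).eventually
    (gt_mem_nhds (show (0 : ℝ≥0∞) < ε by exact_mod_cast hε))
  filter_upwards [h1] with p hp
  have hm : NullMeasurableSet {ω | p.2 < Y i ω} P :=
    nullMeasurableSet_lt aemeasurable_const (hY i)
  rw [tail_map (hY i)]
  rw [ProbabilityTheory.cond, Measure.smul_apply, smul_eq_mul, Measure.restrict_apply₀' hm, mul_comm,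
    ← div_eq_mul_inv] at hp
  by_cases h0 : P {ω | p.2 < Y i ω} = 0
  · exact (measure_mono_null (fun ω h => h.1) h0).le.trans zero_le
  · have := (ENNReal.div_le_iff h0 (measure_ne_top _ _)).1 hp.le
    refine le_trans (measure_mono fun ω h => ?_) this
    exact ⟨h.2, h.1⟩

theorem TAI.negligible [IsFiniteMeasure P] (h : TAI P Y) (hY : ∀ i, AEMeasurable (Y i) P)
    {i j : Fin n} (hij : i ≠ j) :
    Negligible (fun x => P {ω | x < Y i ω ∧ x < Y j ω})
      (fun x => tail (P.map (Y i)) x + tail (P.map (Y j)) x) := by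
  intro ε hε
  filter_upwards [(tendsto_id.prodMk tendsto_id).eventually (h.eventually_measure_le hY hij hε)]
    with x hx
  exact hx.trans (by gcongr; exact le_self_add)

theorem eventually_measure_lt_sum_le_of_TAI [IsFiniteMeasure P] (hn : 1 ≤ n)
    (hY : ∀ i, AEMeasurable (Y i) P)
    (hF : ∀ i, P.map (Y i) ∈ dominatedlyVarying ∩ longTailed)
    (hT : TAI P Y) {ε : ℝ≥0} (hε : 0 < ε) :
    ∀ᶠ x in atTop, P {ω | x < ∑ i, Y i ω} ≤ (1 + ε : ℝ≥0) * ∑ i, tail (P.map (Y i)) x := by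
  have hn' : (1 : ℝ) ≤ n := by exact_mod_cast hn
  have hn0 : (0 : ℝ) < n := by linarith
  -- The factor `2` keeps `c < 1` when `n = 1`.
  set c : ℝ := 1 / (2 * n) with hc
  obtain ⟨K, hK⟩ := exists_eventually_sum_tail_mul_le (fun i => (hF i).1) (b := c)
    (by positivity) (by rw [hc, div_lt_one (by positivity)]; linarith)
  refine eventually_le_one_add_mul (1 + K) (fun ε hε _ => ?_) hε
  have h1 : ∀ i j : Fin n, i ≠ j → ∀ᶠ p : ℝ × ℝ in atTop ×ˢ atTop,
      P {ω | p.2 < Y i ω ∧ p.1 < Y j ω} ≤ (ε / n : ℝ≥0) * tail (P.map (Y i)) p.2 := fun i j hij =>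
    hT.eventually_measure_le hY hij (div_pos hε (by exact_mod_cast hn))
  have h2 : ∀ᶠ p : ℝ × ℝ in atTop ×ˢ atTop, ∀ i j : Fin n, i ≠ j →
      P {ω | p.2 < Y i ω ∧ p.1 < Y j ω} ≤ (ε / n : ℝ≥0) * tail (P.map (Y i)) p.2 := by
    simpa only [eventually_all, eventually_imp_distrib_left] using h1
  -- Currying the product filter fixes one threshold at `a` while the other still tends to infinity.
  obtain ⟨a, ha0, ha⟩ := ((eventually_ge_atTop (0 : ℝ)).and h2.curry).exists
  have hx : Tendsto (fun x : ℝ => x / n) atTop atTop := tendsto_id.atTop_div_const hn0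
  filter_upwards [hx.eventually ha, hK, eventually_ge_atTop 0,
    eventually_all.2 fun i => eventually_tail_sub_le (hF i).2 (n * a) hε] with x h3 h4 hx0 h5
  have e1 : ↑n * a / n = a := by field_simp
  have e2 : c * x ≤ x / n := by
    rw [hc, one_div, inv_mul_eq_div]
    gcongr
    linarith
  calc P {ω | x < ∑ i, Y i ω} ≤ _ := measure_lt_sum_le hY (s := n * a) (by positivity) hn
    _ ≤ ∑ i, (1 + ε : ℝ≥0) * tail (P.map (Y i)) x +
        ∑ i, n * ((ε / n : ℝ≥0) * (K * tail (P.map (Y i)) x)) := by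
        rw [e1]
        refine add_le_add (Finset.sum_le_sum fun i _ => h5 i) (Finset.sum_le_sum fun i _ => ?_)
        calc ∑ j ∈ Finset.univ.erase i, P {ω | x / n < Y i ω ∧ a < Y j ω}
            ≤ ∑ j ∈ Finset.univ.erase i, (ε / n : ℝ≥0) * (K * tail (P.map (Y i)) x) := by
              refine Finset.sum_le_sum fun j hj => ?_
              refine (h3 i j (Finset.ne_of_mem_erase hj).symm).trans ?_
              gcongr
              exact (tail_antitone _ e2).trans (h4 i)
          _ ≤ ∑ j : Fin n, (ε / n : ℝ≥0) * (K * tail (P.map (Y i)) x) :=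
              Finset.sum_le_sum_of_subset (Finset.erase_subset _ _)
          _ = _ := by simp
    _ = (1 + ε : ℝ≥0) * ∑ i, tail (P.map (Y i)) x +
        ((n * (ε / n) * K : ℝ≥0) : ℝ≥0∞) * ∑ i, tail (P.map (Y i)) x := by
        rw [Finset.mul_sum, Finset.mul_sum]
        congr 1
        refine Finset.sum_congr rfl fun i _ => ?_
        push_cast
        ring
    _ ≤ _ := by
        rw [← add_mul, ← ENNReal.coe_add, mul_div_cancel₀ _ (by exact_mod_cast hn0.ne')]
        refine le_of_eq ?_
        congr 2
        ring

end RandomVariables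

/-! ### Reduction of the vector statement to the gauges. -/

section Reduction

variable {Ω : Type*} [MeasurableSpace Ω] {P : Measure Ω} {d n : ℕ}
  {A : Set (Fin d → ℝ)} {X : Fin n → Ω → Fin d → ℝ}

theorem singleBigJump_of_negligible (hn : 1 ≤ n) (hA : A ∈ rareSets d)
    (hpos : ∀ᵐ ω ∂P, ∀ i, 0 ≤ X i ω) (hY : ∀ i, AEMeasurable (radii A X i) P)
    (hF : ∀ i, P.map (radii A X i) ∈ positiveTail)
    (hneg : ∀ i j, i ≠ j → Negligible (fun x => P {ω | x < radii A X i ω ∧ x < radii A X j ω})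
      (fun x => tail (P.map (radii A X i)) x + tail (P.map (radii A X j)) x))
    (hup : ∀ ε : ℝ≥0, 0 < ε → ∀ᶠ x in atTop, P {ω | x < ∑ i, radii A X i ω} ≤
      (1 + ε : ℝ≥0) * ∑ i, tail (P.map (radii A X i)) x) :
    SingleBigJump P A X := by
  set Y := radii A X with hYdef
  set f : ℝ → ℝ≥0∞ := fun x => P {ω | ∑ i, X i ω ∈ x • A} with hf
  have heq : (fun x : ℝ => P {ω | ∑ i, X i ω ∈ x • A} / ∑ i, P {ω | X i ω ∈ x • A}) =ᶠ[atTop]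
      fun x => f x / ∑ i, tail (P.map (Y i)) x := by
    filter_upwards [eventually_gt_atTop 0] with x hx
    congr 1
    refine Finset.sum_congr rfl fun i _ => ?_
    rw [tail_map (hY i)]
    refine measure_congr ?_
    filter_upwards [hpos] with ω hω
    exact propext (lt_setRadius_iff hA (hω i) hx).symm
  refine Tendsto.congr' heq.symm (tendsto_div_nhds_one (fun ε hε => ?_) (fun ε hε => ?_) ?_)
  · filter_upwards [hup ε hε, eventually_gt_atTop 0] with x h1 hx
    refine le_trans (measure_mono_ae ?_) h1
    filter_upwards [hpos] with ω hω h
    have h2 : x < setRadius A (∑ i, X i ω) :=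
      (lt_setRadius_iff hA (Finset.sum_nonneg fun i _ => hω i) hx).2 h
    exact h2.trans_le (setRadius_sum_le hA _ hω)
  · have h1 : Negligible (fun x => ∑ i, ∑ j ∈ Finset.univ.erase i,
        P ({ω | x < Y i ω} ∩ {ω | x < Y j ω})) (fun x => ∑ i, tail (P.map (Y i)) x) := by
      refine Negligible.sum fun i _ => Negligible.sum fun j hj => ?_
      have hij := (Finset.ne_of_mem_erase hj).symm
      refine (hneg i j hij).mono_right fun x => ?_
      rw [← Finset.sum_pair (f := fun i => tail (P.map (Y i)) x) hij]
      exact Finset.sum_le_sum_of_subset (Finset.subset_univ _)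
    filter_upwards [h1 ε hε, eventually_gt_atTop 0] with x h2 hx
    calc ∑ i, tail (P.map (Y i)) x = ∑ i, P {ω | x < Y i ω} := by
          simp_rw [fun i => tail_map (hY i)]
      _ ≤ P (⋃ i, {ω | x < Y i ω}) + ∑ i, ∑ j ∈ Finset.univ.erase i,
          P ({ω | x < Y i ω} ∩ {ω | x < Y j ω}) :=
          sum_measure_le_measure_iUnion_add P fun i =>
            nullMeasurableSet_lt aemeasurable_const (hY i)
      _ ≤ f x + ε * ∑ i, tail (P.map (Y i)) x := by
          refine add_le_add (measure_mono_ae ?_) h2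
          filter_upwards [hpos] with ω hω h
          obtain ⟨i, hi⟩ := mem_iUnion.1 h
          exact sum_mem_smul_of_mem hA hω (Finset.mem_univ i) hx
            ((lt_setRadius_iff hA (hω i) hx).1 hi)
  · filter_upwards [eventually_all.2 fun i => eventually_tail_ne (hF i)] with x hx
    -- Here `n ≥ 1` matters: an empty sum of tails would vanish.
    refine ⟨fun h => (hx ⟨0, hn⟩).1 ?_, by simpa using fun i => (hx i).2⟩
    exact (Finset.sum_eq_zero_iff.1 h) _ (Finset.mem_univ _)

end Reduction

/-! ### Upper bound under regression dependence. -/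

section RegressionDependence

/-- The exceptional null set must not depend on `x`, since the bound is later used at a threshold
depending on `y`. Rational thresholds and continuity from below achieve this. -/
theorem ae_forall_measure_Ioi_le {β : Type*} [MeasurableSpace β] {ν : Measure β}
    {κ : β → Measure ℝ} {F : Measure ℝ} {Q : β → Prop} {x₀ : ℝ} {C : ℝ≥0}
    (h : ∀ x, x₀ < x → ∀ᵐ y ∂ν, Q y → κ y (Ioi x) ≤ C * tail F x) :
    ∀ᵐ y ∂ν, Q y → ∀ x, x₀ < x → κ y (Ioi x) ≤ C * tail F x := by
  have h1 : ∀ᵐ y ∂ν, ∀ q : ℚ, x₀ < q → Q y → κ y (Ioi (q : ℝ)) ≤ C * tail F q := by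
    refine ae_all_iff.2 fun q => ?_
    by_cases hq : x₀ < q
    · filter_upwards [h q hq] with y hy _ using hy
    · exact Eventually.of_forall fun y h => absurd h hq
  filter_upwards [h1] with y hy hQ x hx
  have h2 : Ioi x = ⋃ q : {q : ℚ // x < q}, Ioi ((q : ℚ) : ℝ) := by
    ext z
    simp only [mem_Ioi, mem_iUnion]
    constructor
    · intro hz
      obtain ⟨q, hq, hqz⟩ := exists_rat_btwn hz
      exact ⟨⟨q, hq⟩, hqz⟩
    · rintro ⟨q, hqz⟩
      exact q.2.trans hqz
  have h3 : Directed (· ⊆ ·) fun q : {q : ℚ // x < q} => Ioi ((q : ℚ) : ℝ) :=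
    directed_of_isDirected_ge fun p q hpq => Ioi_subset_Ioi (by exact_mod_cast hpq)
  rw [h2, h3.measure_iUnion]
  refine iSup_le fun q => (hy q (hx.trans q.2) hQ).trans ?_
  gcongr
  exact tail_antitone F q.2.le

variable {Ω : Type*} [MeasurableSpace Ω] {P : Measure Ω} [IsProbabilityMeasure P] {n : ℕ}
  {Y : Fin n → Ω → ℝ}

/-- Given the values `y` of the `Y j`, with sum `τ y > b`, the event forces `Y i` above `max (x - τ
y) b`, a level beyond `x₀`. The regression bound replaces the conditional tail by `C` times the
unconditional one, and integration over `y` gives the independent model. -/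
theorem measure_le_mul_jointTail (hY : ∀ i, AEMeasurable (Y i) P) {J : Finset (Fin n)} {i : Fin n}
    {x₀ : ℝ} {C : ℝ≥0}
    (h : ∀ x, x₀ < x → ∀ᵐ y ∂(P.map (fun ω (j : J) => Y j ω)), (∀ j : J, x₀ < y j) →
      condDistrib (Y i) (fun ω (j : J) => Y j ω) P y (Ioi x) ≤ C * P {ω | x < Y i ω})
    {b : ℝ} (hb : x₀ < b) (x : ℝ) :
    P {ω | (x < ∑ j ∈ J, Y j ω + Y i ω ∧ b < ∑ j ∈ J, Y j ω ∧ b < Y i ω) ∧ ∀ j ∈ J, x₀ < Y j ω} ≤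
      C * jointTail (P.map fun ω => ∑ j ∈ J, Y j ω) (P.map (Y i)) x b := by
  set Z : Ω → J → ℝ := fun ω j => Y j ω with hZ
  have hZm : AEMeasurable Z P := aemeasurable_pi_lambda _ fun j => hY j
  set τ : (J → ℝ) → ℝ := fun y => ∑ j, y j with hτ
  have hτm : Measurable τ := Finset.measurable_fun_sum _ fun j _ => measurable_pi_apply j
  have hτZ : ∀ ω, ∑ j ∈ J, Y j ω = τ (Z ω) := fun ω =>
    (Finset.sum_coe_sort J fun j => Y j ω).symm
  simp_rw [← tail_map (hY i)] at h
  have hae := ae_forall_measure_Ioi_le h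
  set B : Set ((J → ℝ) × ℝ) :=
    {p | (x < τ p.1 + p.2 ∧ b < τ p.1 ∧ b < p.2) ∧ ∀ j, x₀ < p.1 j} with hB
  have hBm : MeasurableSet B := by
    refine MeasurableSet.inter ?_ ?_
    · exact (measurableSet_lt measurable_const ((hτm.comp measurable_fst).add measurable_snd)).inter
        ((measurableSet_lt measurable_const (hτm.comp measurable_fst)).inter
          (measurableSet_lt measurable_const measurable_snd))
    · have : {p : (J → ℝ) × ℝ | ∀ j, x₀ < p.1 j} = ⋂ j, {p | x₀ < p.1 j} := by
        ext p; simp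
      change MeasurableSet {p : (J → ℝ) × ℝ | ∀ j, x₀ < p.1 j}
      rw [this]
      exact MeasurableSet.iInter fun j =>
        measurableSet_lt measurable_const ((measurable_pi_apply j).comp measurable_fst)
  have hset : {ω | (x < ∑ j ∈ J, Y j ω + Y i ω ∧ b < ∑ j ∈ J, Y j ω ∧ b < Y i ω) ∧
      ∀ j ∈ J, x₀ < Y j ω} = (fun ω => (Z ω, Y i ω)) ⁻¹' B := by
    ext ω
    simp only [hτZ, hB, hZ, mem_ofPred_eq, mem_preimage, Subtype.forall]
  have hmap : (P.map Z).map τ = P.map fun ω => ∑ j ∈ J, Y j ω := by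
    rw [AEMeasurable.map_map_of_aemeasurable hτm.aemeasurable hZm]
    congr 1
    exact funext fun ω => (hτZ ω).symm
  rw [hset, ← Measure.map_apply_of_aemeasurable (hZm.prodMk (hY i)) hBm,
    ← compProd_map_condDistrib (hY i), Measure.compProd_apply hBm, ← hmap, jointTail_eq_lintegral,
    lintegral_map (measurable_indicator_tail _ x b) hτm,
    ← lintegral_const_mul _ (by exact (measurable_indicator_tail _ x b).comp hτm)]
  refine lintegral_mono_ae ?_
  filter_upwards [hae] with y hy
  by_cases hQ : ∀ j : J, x₀ < y j
  · by_cases hb' : b < τ y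
    · rw [indicator_of_mem (mem_Ioi.2 hb')]
      refine le_trans (measure_mono ?_) (hy hQ _ (hb.trans_le (le_max_right (x - τ y) b)))
      rintro t ⟨⟨h1, -, h3⟩, -⟩
      exact max_lt (sub_lt_iff_lt_add'.2 h1) h3
    · refine (measure_mono_null (fun t ht => hb' ht.1.2.1) measure_empty).le.trans zero_le
  · exact (measure_mono_null (fun t ht => hQ ht.2) measure_empty).le.trans zero_le

theorem RegressionDependent.negligible (h : RegressionDependent P Y)
    (hY : ∀ i, AEMeasurable (Y i) P) (hF : ∀ i, P.map (Y i) ∈ longTailed)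
    (hFF : ∀ i j, i ≠ j → (P.map (Y i)).conv (P.map (Y j)) ∈ subexponential)
    {i j : Fin n} (hij : i ≠ j) :
    Negligible (fun x => P {ω | x < Y i ω ∧ x < Y j ω})
      (fun x => tail (P.map (Y i)) x + tail (P.map (Y j)) x) := by
  obtain ⟨x₀, C, h⟩ := h
  intro ε hε
  have hC : 0 < C + 1 := by positivity
  obtain ⟨b, hb, hb0⟩ := ((eventually_jointTail_le (hF i) (hF j) (hFF i j hij)
    (div_pos hε hC)).and (eventually_gt_atTop (max x₀ 0))).exists
  have hbx : x₀ < b := (le_max_left _ _).trans_lt hb0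
  have hb0 : 0 < b := (le_max_right _ _).trans_lt hb0
  have h1 := measure_le_mul_jointTail hY
    (h j {i} (Finset.singleton_nonempty i) (by simpa using hij.symm)) hbx
  simp only [Finset.sum_singleton, Finset.mem_singleton, forall_eq] at h1
  filter_upwards [hb, eventually_ge_atTop b] with x h2 hxb
  calc P {ω | x < Y i ω ∧ x < Y j ω} ≤
      P {ω | (x < Y i ω + Y j ω ∧ b < Y i ω ∧ b < Y j ω) ∧ x₀ < Y i ω} := by
        refine measure_mono fun ω hω => ?_
        obtain ⟨h3, h4⟩ := hω
        exact ⟨⟨by linarith, by linarith, by linarith⟩, by linarith⟩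
    _ ≤ C * jointTail (P.map (Y i)) (P.map (Y j)) x b := h1 x
    _ ≤ (C + 1 : ℝ≥0) * ((ε / (C + 1) : ℝ≥0) * (tail (P.map (Y i)) x + tail (P.map (Y j)) x)) := by
        gcongr
        simp
    _ = ε * (tail (P.map (Y i)) x + tail (P.map (Y j)) x) := by
        rw [← mul_assoc, ← ENNReal.coe_mul, mul_div_cancel₀ _ hC.ne']

theorem eventually_measure_lt_sum_le_of_regressionDependent (hY : ∀ i, AEMeasurable (Y i) P)
    (hF : ∀ i, P.map (Y i) ∈ longTailed)
    (hFF : ∀ i j, i ≠ j → (P.map (Y i)).conv (P.map (Y j)) ∈ subexponential)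
    (h : RegressionDependent P Y) (J : Finset (Fin n)) :
    ∀ ε : ℝ≥0, 0 < ε → ∀ᶠ x in atTop,
      P {ω | x < ∑ j ∈ J, Y j ω} ≤ (1 + ε : ℝ≥0) * ∑ j ∈ J, tail (P.map (Y j)) x := by
  classical
  obtain ⟨x₀, C, h⟩ := h
  induction J using Finset.strongInduction with
  | H J ih =>
  rcases J.eq_empty_or_nonempty with rfl | ⟨i, hi⟩
  · intro ε _
    filter_upwards [eventually_ge_atTop 0] with x hx
    simp [not_lt.2 hx]
  set J₀ := J.erase i with hJ₀
  have hsub : J₀ ⊂ J := Finset.erase_ssubset hi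
  -- Regression dependence says nothing about `Y j ≤ x₀`. Such variables contribute at most `M` to
  -- the sum, and the event is split according to the subset `J'` of indices with `Y j > x₀`.
  set M : ℝ := n * max x₀ 0 with hM
  set D : ℝ → ℝ≥0∞ := fun x => ∑ j ∈ J, tail (P.map (Y j)) x with hD
  have hDJ : ∀ j ∈ J, ∀ x, tail (P.map (Y j)) x ≤ D x := fun j hj x =>
    Finset.single_le_sum (f := fun j => tail (P.map (Y j)) x) (fun _ _ => zero_le) hj
  have hDsub : ∀ a : ℝ, ∀ ε : ℝ≥0, 0 < ε → ∀ᶠ x in atTop, ∀ j : Fin n,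
      tail (P.map (Y j)) (x - a) ≤ (1 + ε : ℝ≥0) * tail (P.map (Y j)) x := fun a ε hε =>
    eventually_all.2 fun j => eventually_tail_sub_le (hF j) a hε
  intro ε hε
  -- The factors count the subsets `J'`, the regression constant, the crude inductive bound, and at
  -- most `n` pairs, each costing `2 * D (x - M) ≤ 4 * D x`.
  set L : ℝ≥0 := 2 ^ J₀.card * (C * (2 * (n * 4))) with hL
  refine eventually_le_one_add_mul (3 + L) (fun ε hε hε1 => ?_) hε
  have hpair : ∀ᶠ b in atTop, ∀ j : Fin n, j ≠ i → ∀ᶠ x in atTop,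
      jointTail (P.map (Y i)) (P.map (Y j)) x b ≤
        ε * (tail (P.map (Y i)) x + tail (P.map (Y j)) x) := by
    refine eventually_all.2 fun j => eventually_imp_distrib_left.2 fun hj => ?_
    exact eventually_jointTail_le (hF i) (hF j) (hFF i j hj.symm) hε
  -- The induction hypothesis with `ε = 1`, made uniform beyond `b`, as `jointTail_le_sum` requires.
  have hind : ∀ᶠ b : ℝ in atTop, ∀ J' ∈ J₀.powerset, ∀ t, b ≤ t →
      tail (P.map fun ω => ∑ j ∈ J', Y j ω) t ≤ (2 : ℝ≥0) * ∑ j ∈ J', tail (P.map (Y j)) t := by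
    refine (Filter.eventually_all_finset _).2 fun J' hJ' => ?_
    have h1 := ih J' ((Finset.mem_powerset.1 hJ').trans_ssubset hsub) 1 one_pos
    rw [one_add_one_eq_two] at h1
    simp_rw [← tail_map (Finset.aemeasurable_fun_sum J' fun j _ => hY j)] at h1
    exact eventually_forall_ge_atTop.2 h1
  obtain ⟨b, hb1, hb2, hb3⟩ :=
    (hpair.and (hind.and (eventually_gt_atTop (max x₀ 0)))).exists
  have hbx : x₀ < b := (le_max_left _ _).trans_lt hb3
  have hb0 : 0 < b := (le_max_right _ _).trans_lt hb3
  have hM0 : 0 ≤ M := by positivity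
  -- If neither the sum over `J₀` nor `Y i` exceeds `x - a`, then each exceeds `a`, so the sum over
  -- `J'` still exceeds `b`.
  set a := b + M with ha
  have hpart : ∀ ω, ∑ j ∈ J₀, Y j ω ≤ ∑ j ∈ J₀.filter (fun j => x₀ < Y j ω), Y j ω + M := by
    intro ω
    rw [← Finset.sum_filter_add_sum_filter_not J₀ fun j => x₀ < Y j ω]
    gcongr
    calc ∑ j ∈ J₀.filter (fun j => ¬ x₀ < Y j ω), Y j ω
        ≤ ∑ j ∈ J₀.filter (fun j => ¬ x₀ < Y j ω), max x₀ 0 := by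
          refine Finset.sum_le_sum fun j hj => ?_
          exact (not_lt.1 (Finset.mem_filter.1 hj).2).trans (le_max_left _ _)
      _ ≤ ∑ _j : Fin n, max x₀ 0 := Finset.sum_le_sum_of_subset_of_nonneg
          (Finset.subset_univ _) fun _ _ _ => le_max_right _ _
      _ = M := by simp [hM]
  have hjoint : ∀ J' ∈ J₀.powerset, ∀ᶠ x in atTop,
      P {ω | (x < ∑ j ∈ J', Y j ω + Y i ω ∧ b < ∑ j ∈ J', Y j ω ∧ b < Y i ω) ∧
        ∀ j ∈ J', x₀ < Y j ω} ≤ (C * (2 * (n * 2)) : ℝ≥0) * ε * D x := by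
    intro J' hJ'
    have hJ'i : ∀ j ∈ J', j ≠ i := fun j hj =>
      Finset.ne_of_mem_erase (Finset.mem_powerset.1 hJ' hj)
    have hJ'J : ∀ j ∈ J', j ∈ J := fun j hj =>
      Finset.mem_of_mem_erase (Finset.mem_powerset.1 hJ' hj)
    rcases J'.eq_empty_or_nonempty with rfl | hne
    · refine Eventually.of_forall fun x => ?_
      simp [not_lt.2 hb0.le]
    filter_upwards [(Filter.eventually_all_finset J').2 fun j hj => hb1 j (hJ'i j hj)] with x hx
    have : IsProbabilityMeasure (P.map fun ω => ∑ j ∈ J', Y j ω) :=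
      Measure.isProbabilityMeasure_map (Finset.aemeasurable_fun_sum J' fun j _ => hY j)
    have : ∀ j, IsProbabilityMeasure (P.map (Y j)) := fun j =>
      Measure.isProbabilityMeasure_map (hY j)
    calc _ ≤ C * jointTail (P.map fun ω => ∑ j ∈ J', Y j ω) (P.map (Y i)) x b :=
          measure_le_mul_jointTail hY (h i J' hne fun hi' => hJ'i i hi' rfl) hbx x
      _ ≤ C * ((2 : ℝ≥0) * ∑ j ∈ J', jointTail (P.map (Y i)) (P.map (Y j)) x b) := by
          rw [jointTail_comm]
          gcongr
          exact jointTail_le_sum (hb2 J' hJ') x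
      _ ≤ C * ((2 : ℝ≥0) * ∑ _j : Fin n, ε * (D x + D x)) := by
          gcongr
          refine (Finset.sum_le_sum fun j hj => (hx j hj).trans ?_).trans
            (Finset.sum_le_sum_of_subset (Finset.subset_univ J'))
          gcongr
          · exact hDJ i hi x
          · exact hDJ j (hJ'J j hj) x
      _ = (C * (2 * (n * 2)) : ℝ≥0) * ε * D x := by
          simp only [Finset.sum_const, Finset.card_univ, Fintype.card_fin, nsmul_eq_mul]
          push_cast
          ring
  have hshift : Tendsto (fun x : ℝ => x - M) atTop atTop :=
    tendsto_atTop_add_const_right _ _ tendsto_id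
  have hshift' : Tendsto (fun x : ℝ => x - a) atTop atTop :=
    tendsto_atTop_add_const_right _ _ tendsto_id
  filter_upwards [hshift.eventually ((Filter.eventually_all_finset _).2 hjoint),
    hshift'.eventually (ih J₀ hsub ε hε), hDsub a ε hε, hDsub M 1 one_pos] with x h1 h2 h3 h4
  have h5 : D (x - M) ≤ 2 * D x := by
    rw [hD]
    simp only [Finset.mul_sum]
    refine Finset.sum_le_sum fun j _ => (h4 j).trans ?_
    rw [one_add_one_eq_two, ENNReal.coe_ofNat]
  have h6 : {ω | x < ∑ j ∈ J, Y j ω} ⊆ {ω | x - a < ∑ j ∈ J₀, Y j ω} ∪ {ω | x - a < Y i ω} ∪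
      ⋃ J' ∈ J₀.powerset, {ω | (x - M < ∑ j ∈ J', Y j ω + Y i ω ∧ b < ∑ j ∈ J', Y j ω ∧
        b < Y i ω) ∧ ∀ j ∈ J', x₀ < Y j ω} := by
    intro ω hω
    rw [mem_ofPred_eq, ← Finset.sum_erase_add _ _ hi] at hω
    have h7 := hpart ω
    by_cases h8 : x - a < ∑ j ∈ J₀, Y j ω
    · exact Or.inl (Or.inl h8)
    by_cases h9 : x - a < Y i ω
    · exact Or.inl (Or.inr h9)
    refine Or.inr (mem_iUnion₂.2 ⟨J₀.filter fun j => x₀ < Y j ω,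
      Finset.mem_powerset.2 (Finset.filter_subset _ _), ⟨?_, ?_, ?_⟩, ?_⟩)
    · linarith
    · linarith
    · linarith
    · exact fun j hj => (Finset.mem_filter.1 hj).2
  calc P {ω | x < ∑ j ∈ J, Y j ω} ≤ (1 + ε : ℝ≥0) * ∑ j ∈ J₀, tail (P.map (Y j)) (x - a) +
        tail (P.map (Y i)) (x - a) +
        ∑ _J' ∈ J₀.powerset, (C * (2 * (n * 2)) : ℝ≥0) * ε * D (x - M) := by
        refine (measure_mono h6).trans ((measure_union_le _ _).trans (add_le_add ?_ ?_))
        · refine (measure_union_le _ _).trans (add_le_add h2 ?_)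
          rw [tail_map (hY i)]
        · exact (measure_biUnion_finset_le _ _).trans (Finset.sum_le_sum h1)
    _ ≤ (1 + ε : ℝ≥0) * ∑ j ∈ J₀, (1 + ε : ℝ≥0) * tail (P.map (Y j)) x +
        (1 + ε : ℝ≥0) * ((1 + ε : ℝ≥0) * tail (P.map (Y i)) x) +
        ∑ _J' ∈ J₀.powerset, (C * (2 * (n * 2)) : ℝ≥0) * ε * (2 * D x) := by
        gcongr with j hj
        · exact h3 j
        · refine (h3 i).trans ?_
          exact le_mul_of_one_le_left' (by simp)
    _ = ((1 + ε) * (1 + ε) + L * ε : ℝ≥0) * D x := by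
        have e1 : D x = ∑ j ∈ J₀, tail (P.map (Y j)) x + tail (P.map (Y i)) x :=
          (Finset.sum_erase_add _ _ hi).symm
        rw [Finset.sum_const, Finset.card_powerset, ← Finset.mul_sum, hL, nsmul_eq_mul, e1]
        push_cast
        ring
    _ ≤ _ := by
        refine mul_le_mul' (ENNReal.coe_le_coe.2 ?_) le_rfl
        calc (1 + ε) * (1 + ε) + L * ε = 1 + (2 * ε + ε * ε) + L * ε := by ring
          _ ≤ 1 + (2 * ε + 1 * ε) + L * ε := by gcongr
          _ = 1 + (3 + L) * ε := by ring

end RegressionDependence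

/-! ### The three cases assembled. -/

theorem mainTheorem2 {Ω : Type*} [MeasurableSpace Ω] (P : Measure Ω) [IsProbabilityMeasure P]
    (d n : ℕ) (hn : 1 ≤ n) (A : Set (Fin d → ℝ)) (hA : A ∈ rareSets d)
    (X : Fin n → Ω → Fin d → ℝ) (hX : ∀ i, Measurable (X i))
    (hpos : ∀ i, ∀ᵐ ω ∂P, ∀ k, 0 ≤ X i ω k) :
    ((∀ i, P.map (X i) ∈ classOn consistentlyVarying A) →
        QAI P (radii A X) →
        SingleBigJump P A X) ∧
    ((∀ i, P.map (X i) ∈ classOn (dominatedlyVarying ∩ longTailed) A) →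
        TAI P (radii A X) →
        SingleBigJump P A X) ∧
    ((∀ i, P.map (X i) ∈ classOn subexponential A) →
        RegressionDependent P (radii A X) →
        (∀ i j : Fin n, i ≠ j →
          (lawOn A (P.map (X i))).conv (lawOn A (P.map (X j))) ∈ subexponential) →
        SingleBigJump P A X) := by
  have hpos' : ∀ᵐ ω ∂P, ∀ i, 0 ≤ X i ω := ae_all_iff.2 hpos
  have hr : ∀ i, AEMeasurable (setRadius A) (P.map (X i)) := fun i =>
    aemeasurable_setRadius hA
      ((ae_map_iff (hX i).aemeasurable measurableSet_Ici).2 (hpos i))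
  have hY : ∀ i, AEMeasurable (radii A X i) P := fun i => (hr i).comp_measurable (hX i)
  have hlaw : ∀ i, lawOn A (P.map (X i)) = P.map (radii A X i) := fun i =>
    AEMeasurable.map_map_of_aemeasurable (hr i) (hX i).aemeasurable
  simp only [classOn, mem_ofPred_eq, hlaw]
  refine ⟨fun hF hQ => ?_, fun hF hT => ?_, fun hF hR hFF => ?_⟩
  · exact singleBigJump_of_negligible hn hA hpos' hY (fun i => (hF i).1)
      (fun i j hij => hQ.negligible hY (fun i => (hF i).1) hij)
      fun ε hε => eventually_measure_lt_sum_le_of_QAI hn hY hF hQ hε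
  · exact singleBigJump_of_negligible hn hA hpos' hY (fun i => (hF i).2.1)
      (fun i j hij => hT.negligible hY hij)
      fun ε hε => eventually_measure_lt_sum_le_of_TAI hn hY hF hT hε
  · have hL := fun i => subexponential_subset_longTailed (hF i)
    exact singleBigJump_of_negligible hn hA hpos' hY (fun i => (hF i).1)
      (fun i j hij => hR.negligible hY hL hFF hij)
      fun ε hε => eventually_measure_lt_sum_le_of_regressionDependent hY hL hFF hR Finset.univ ε hε
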